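/- Let $n\ge2$, let $\Omega\subset\mathbb R^n$ be a bounded domain with infinitely smooth boundary $\Gamma$, and let $q\ge1$. Consider a boundary-value problem $Au=f$ in $\Omega$, $B_ju=g_j$ on $\Gamma$ ($j=1,\dots,q$), where $A=\sum_{|\mu|\le2q}a_\mu(x)D^\mu$ and $B_j=\sum_{|\mu|\le m_j}b_{j,\mu}(x)D^\mu$, $m_j\le2q-1$, have coefficients in $C^\infty(\overline\Omega)$ and $C^\infty(\Gamma)$ respectively, and suppose that it is elliptic in $\Omega$: $A$ is properly elliptic on $\overline\Omega$ and $B=(B_1,\dots,B_q)$ satisfies the Lopatynsky condition with respect to $A$ on $\Gamma$. Put $m=\max_j m_j$. Let $\mathrm{RO}$ be the class of Borel measurable functions $\alpha:[1,\infty)\to(0,\infty)$ for which there are $b>1$, $c\ge1$ with $c^{-1}\le\alpha(\lambda t)/\alpha(t)\le c$ for all $t\ge1$, $\lambda\in[1,b]$, and let $\sigma_0(\alpha)$ be the supremum of all $s\in\mathbb R$ such that, for some $c_0>0$, $\alpha(\lambda t)/\alpha(t)\ge c_0\lambda^{s}$ for all $t,\lambda\ge1$. For $\alpha\in\mathrm{RO}$,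 $H^\alpha(\mathbb R^d)$ is the space of tempered distributions $w$ whose Fourier transform is locally integrable with $\int\alpha^2((1+|\xi|^2)^{1/2})|\widehat w(\xi)|^2d\xi<\infty$; $H^\alpha(\Omega)$ consists of the restrictions to $\Omega$ of the elements of $H^\alpha(\mathbb R^n)$, with the quotient norm; $H^\alpha(\Gamma)$ consists of the distributions on $\Gamma$ that belong to $H^\alpha(\mathbb R^{n-1})$ in local coordinates. Put $H^{m+1/2+}(\Omega)=\bigcup\{H^\alpha(\Omega):\alpha\in\mathrm{RO},\ \sigma_0(\alpha)>m+1/2\}$. For $u$ in this space, $(A,B)u\in\mathcal D'(\Omega)\times(\mathcal D'(\Gamma))^q$ is defined by extending $u\mapsto(Au,B_1u,\dots,B_qu)$ by continuity from $C^\infty(\overline\Omega)$. Let $V\subset\mathbb R^n$ be open with $\Omega_0:=\Omega\cap V\ne\varnothing$, and put $\Gamma_0:=\Gamma\cap V$. Let $H^\alpha_{\mathrm{loc}}(\Omega_0,\Gamma_0)$ be the set of $u\in\mathcal D'(\Omega)$ with $\chi u\in H^\alpha(\Omega)$ for all $\chi\in C^\infty(\overline\Omega)$ with $\operatorname{supp}\chi\subset\Omega_0\cup\Gamma_0$,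 let $H^\alpha_{\mathrm{loc}}(\Gamma_0)$ be the set of $h\in\mathcal D'(\Gamma)$ with $\chi h\in H^\alpha(\Gamma)$ for all $\chi\in C^\infty(\Gamma)$ with $\operatorname{supp}\chi\subset\Gamma_0$, and, with $\rho(t)=t$, put $$\mathcal H^{\varphi\rho^{-2q}}_{\mathrm{loc}}(\Omega_0,\Gamma_0)=H^{\varphi\rho^{-2q}}_{\mathrm{loc}}(\Omega_0,\Gamma_0)\oplus\bigoplus_{j=1}^qH^{\varphi\rho^{-m_j-1/2}}_{\mathrm{loc}}(\Gamma_0).$$ Let $p\ge0$ be an integer and let $\varphi\in\mathrm{RO}$ with $\sigma_0(\varphi)>m+1/2$. Suppose that the implication $$\bigl(u\in H^{m+1/2+}(\Omega)\ \text{ and }\ (A,B)u\in\mathcal H^{\varphi\rho^{-2q}}_{\mathrm{loc}}(\Omega_0,\Gamma_0)\bigr)\ \Longrightarrow\ u\in C^p(\Omega_0\cup\Gamma_0)$$ holds for all $u$. Then $$\int_1^\infty t^{2p+n-1}\varphi^{-2}(t)\,dt<\infty.$$ -/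

import Mathlib

open MeasureTheory Set Filter Topology TopologicalSpace
open scoped ContDiff Distributions SchwartzMap FourierTransform ENNReal Gradient InnerProductSpace

noncomputable section

namespace ExtendedSobolev

/-- The Euclidean space `ℝⁿ`. -/
abbrev Eu (n : ℕ) : Type := EuclideanSpace ℝ (Fin n)

/-! ### RO-varying functions -/

/-- The class `RO` of functions `α : [1,∞) → (0,∞)` that are RO-varying at infinity. Functions are
total on `ℝ`; only their values on `[1,∞)` matter. -/
structure IsRO (α : ℝ → ℝ) : Prop where
  measurable : Measurable (fun t : Ici (1 : ℝ) => α t)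
  pos : ∀ t, 1 ≤ t → 0 < α t
  bounded : ∃ b > (1 : ℝ), ∃ c ≥ (1 : ℝ), ∀ t ≥ (1 : ℝ), ∀ l ∈ Icc 1 b,
    c⁻¹ ≤ α (l * t) / α t ∧ α (l * t) / α t ≤ c

/-- The lower Matuszewska index `σ₀(α)`. -/
def lowerIndex (α : ℝ → ℝ) : ℝ :=
  sSup {s : ℝ | ∃ c > (0 : ℝ), ∀ t ≥ (1 : ℝ), ∀ l ≥ (1 : ℝ), c * l ^ s ≤ α (l * t) / α t}

/-- The function parameter `t ↦ α(t) t ^ s`. -/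
def mulRho (α : ℝ → ℝ) (s : ℝ) : ℝ → ℝ := fun t => α t * t ^ s

/-! ### Hörmander spaces over `ℝᵈ` -/

/-- The Fourier transform of the tempered distribution `w` is the locally integrable function
`g`. -/
def HasFourierFunction {d : ℕ} (w : 𝓢'(Eu d, ℂ)) (g : Eu d → ℂ) : Prop :=
  LocallyIntegrable g ∧ ∀ ψ : 𝓢(Eu d, ℂ), (𝓕 w : 𝓢'(Eu d, ℂ)) ψ = ∫ ξ, g ξ * ψ ξ

/-- `∫ α((1+|ξ|²)^{1/2})² |g(ξ)|² dξ`. -/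
def weightedSq {d : ℕ} (α : ℝ → ℝ) (g : Eu d → ℂ) : ℝ≥0∞ :=
  ∫⁻ ξ, ENNReal.ofReal (α (Real.sqrt (1 + ‖ξ‖ ^ 2)) ^ 2 * ‖g ξ‖ ^ 2)

/-- `w ∈ H^α(ℝᵈ)`. -/
def MemH {d : ℕ} (α : ℝ → ℝ) (w : 𝓢'(Eu d, ℂ)) : Prop :=
  ∃ g : Eu d → ℂ, HasFourierFunction w g ∧ weightedSq α g < ⊤

/-- The norm of `w` in `H^α(ℝᵈ)` (the function `g` is unique almost everywhere; the value is `∞`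
if there is none). -/
def hNorm {d : ℕ} (α : ℝ → ℝ) (w : 𝓢'(Eu d, ℂ)) : ℝ≥0∞ :=
  ⨅ (g : Eu d → ℂ) (_ : HasFourierFunction w g), weightedSq α g ^ (1 / 2 : ℝ)

/-! ### Distributions and Hörmander spaces over an open set -/

/-- Complex distributions on the open set `Ω`. -/
abbrev Distr {n : ℕ} (Ω : Opens (Eu n)) : Type := 𝓓(Ω, ℂ) →L[ℂ] ℂ

/-- A test function on `Ω`, as a Schwartz function on `ℝⁿ`. -/
def toSchwartz {n : ℕ} {Ω : Opens (Eu n)} (ψ : 𝓓(Ω, ℂ)) : 𝓢(Eu n, ℂ) :=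
  ψ.hasCompactSupport.toSchwartzMap ψ.contDiff

/-- The product of a smooth function and a test function. -/
def smoothMul {n : ℕ} {Ω : Opens (Eu n)} (χ : Eu n → ℂ) (hχ : ContDiff ℝ ∞ χ) (ψ : 𝓓(Ω, ℂ)) :
    𝓓(Ω, ℂ) where
  toFun := fun x => χ x * ψ x
  contDiff' := hχ.mul ψ.contDiff
  hasCompactSupport' := ψ.hasCompactSupport.mul_left
  tsupport_subset' := (tsupport_mul_subset_right (f := χ) (g := ψ)).trans ψ.tsupport_subset

/-- The functional `T` is the restriction to `Ω` of the tempered distribution `w`. -/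
def IsRestriction {n : ℕ} (Ω : Opens (Eu n)) (w : 𝓢'(Eu n, ℂ)) (T : 𝓓(Ω, ℂ) → ℂ) : Prop :=
  ∀ ψ : 𝓓(Ω, ℂ), w (toSchwartz ψ) = T ψ

/-- `T ∈ H^α(Ω)`: restriction to `Ω` of an element of `H^α(ℝⁿ)`. -/
def MemHDomain {n : ℕ} (Ω : Opens (Eu n)) (α : ℝ → ℝ) (T : 𝓓(Ω, ℂ) → ℂ) : Prop :=
  ∃ w : 𝓢'(Eu n, ℂ), MemH α w ∧ IsRestriction Ω w T

/-- The norm in `H^α(Ω)`: the infimum of the norms of the extensions in `H^α(ℝⁿ)`. -/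
def hNormDomain {n : ℕ} (Ω : Opens (Eu n)) (α : ℝ → ℝ) (T : 𝓓(Ω, ℂ) → ℂ) : ℝ≥0∞ :=
  ⨅ (w : 𝓢'(Eu n, ℂ)) (_ : MemH α w ∧ IsRestriction Ω w T), hNorm α w

/-- The distribution on `Ω` given by the function `f`. -/
def ofFun {n : ℕ} (Ω : Opens (Eu n)) (f : Eu n → ℂ) : 𝓓(Ω, ℂ) → ℂ :=
  fun ψ => ∫ x, f x * ψ x

/-- `u ∈ H^{r+}(Ω)`, the union of the spaces `H^α(Ω)` over `α ∈ RO` with `σ₀(α) > r`. -/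
def MemHPlus {n : ℕ} (Ω : Opens (Eu n)) (r : ℝ) (u : Distr Ω) : Prop :=
  ∃ α : ℝ → ℝ, IsRO α ∧ r < lowerIndex α ∧ MemHDomain Ω α u

/-- The set `Ω₀ ∪ Γ₀`, where `Ω₀ = Ω ∩ V` and `Γ₀ = ∂Ω ∩ V`. -/
def localClosure {n : ℕ} (Ω : Opens (Eu n)) (V : Set (Eu n)) : Set (Eu n) :=
  ((Ω : Set (Eu n)) ∩ V) ∪ (frontier (Ω : Set (Eu n)) ∩ V)

/-- `u ∈ H^α_loc(Ω₀, Γ₀)`: `χu ∈ H^α(Ω)` for every `χ ∈ C^∞(Ω̄)` with support in `Ω₀ ∪ Γ₀`. -/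
def MemHLoc {n : ℕ} (Ω : Opens (Eu n)) (V : Set (Eu n)) (α : ℝ → ℝ) (u : Distr Ω) : Prop :=
  ∀ (χ : Eu n → ℂ) (hχ : ContDiff ℝ ∞ χ),
    closure (closure (Ω : Set (Eu n)) ∩ Function.support χ) ⊆ localClosure Ω V →
      MemHDomain Ω α (fun ψ => u (smoothMul χ hχ ψ))

/-- `u ∈ C^p(Ω₀ ∪ Γ₀)`: on `Ω₀` the distribution `u` is a function that is `p` times continuously
differentiable up to `Γ₀`. -/
def MemCLoc {n : ℕ} (Ω : Opens (Eu n)) (V : Set (Eu n)) (p : ℕ) (u : Distr Ω) : Prop :=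
  ∃ f : Eu n → ℂ, ContDiffOn ℝ p f (localClosure Ω V) ∧
    ∀ ψ : 𝓓(Ω, ℂ), tsupport ψ ⊆ V → u ψ = ∫ x, f x * ψ x

/-! ### Bounded domains with smooth boundary -/

/-- Near the boundary point `x`, the set `Ω` is `{r > 0}` for the smooth function `r` with
nonvanishing differential at `x`. -/
def IsLocalDefiningFunction {n : ℕ} (Ω : Opens (Eu n)) (x : Eu n) (r : Eu n → ℝ) : Prop :=
  ∃ U : Set (Eu n), IsOpen U ∧ x ∈ U ∧ ContDiffOn ℝ ∞ r U ∧ fderiv ℝ r x ≠ 0 ∧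
    (Ω : Set (Eu n)) ∩ U = {y ∈ U | 0 < r y}

/-- A bounded domain (nonempty connected open set) with infinitely smooth boundary. -/
structure IsSmoothBoundedDomain {n : ℕ} (Ω : Opens (Eu n)) : Prop where
  connected : IsConnected (Ω : Set (Eu n))
  bounded : Bornology.IsBounded (Ω : Set (Eu n))
  smooth_boundary : ∀ x ∈ frontier (Ω : Set (Eu n)), ∃ r, IsLocalDefiningFunction Ω x r

/-- `ν` is the unit inward normal to the boundary of `Ω` at `x`. -/
def IsInwardNormal {n : ℕ} (Ω : Opens (Eu n)) (x ν : Eu n) : Prop :=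
  ∃ r, IsLocalDefiningFunction Ω x r ∧ ν = ‖∇ r x‖⁻¹ • ∇ r x

/-- `f ∈ C^∞(S)` for a compact set `S` (here `Ω̄` or `Γ`): `f` coincides on `S` with a smooth
function on `ℝⁿ`. -/
def SmoothOn {n : ℕ} (S : Set (Eu n)) (f : Eu n → ℂ) : Prop :=
  ∃ F : Eu n → ℂ, ContDiff ℝ ∞ F ∧ EqOn f F S

/-! ### Distributions and Hörmander spaces on the boundary -/

/-- The algebra `C^∞(Γ)` of infinitely smooth complex functions on a compact submanifold `Γ`
of `ℝⁿ`. -/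
def BdSmooth {n : ℕ} (Γ : Set (Eu n)) : Subalgebra ℂ (Γ → ℂ) where
  carrier := {f | ∃ F : Eu n → ℂ, ContDiff ℝ ∞ F ∧ ∀ x : Γ, f x = F x}
  mul_mem' := by
    rintro f g ⟨F, hF, hf⟩ ⟨G, hG, hg⟩
    exact ⟨F * G, hF.mul hG, fun x => by simp [hf, hg]⟩
  add_mem' := by
    rintro f g ⟨F, hF, hf⟩ ⟨G, hG, hg⟩
    exact ⟨F + G, hF.add hG, fun x => by simp [hf, hg]⟩
  algebraMap_mem' := fun c => ⟨fun _ => c, contDiff_const, fun x => by simp⟩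

/-- Restriction to `Γ` of a smooth function on `ℝⁿ`. -/
def BdSmooth.restrict {n : ℕ} (Γ : Set (Eu n)) (F : Eu n → ℂ) (hF : ContDiff ℝ ∞ F) :
    BdSmooth Γ :=
  ⟨fun x => F x, F, hF, fun _ => rfl⟩

/-- The linear functional `T` on `C^∞(Γ)` is a distribution on `Γ`, i.e. it is continuous:
`|T(F|_Γ)|` is bounded by finitely many derivatives of `F` on `Γ`. -/
def IsBdDistr {n : ℕ} {Γ : Set (Eu n)} (T : BdSmooth Γ →ₗ[ℂ] ℂ) : Prop :=
  ∃ (N : ℕ) (C : ℝ), ∀ (F : Eu n → ℂ) (hF : ContDiff ℝ ∞ F) (M : ℝ),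
    (∀ k ≤ N, ∀ x ∈ Γ, ‖iteratedFDeriv ℝ k F x‖ ≤ M) →
      ‖T (BdSmooth.restrict Γ F hF)‖ ≤ C * M

/-- The product of the function `χ ∈ C^∞(Γ)` and a distribution on `Γ`. -/
def bdMul {n : ℕ} {Γ : Set (Eu n)} (χ : BdSmooth Γ) (T : BdSmooth Γ →ₗ[ℂ] ℂ) :
    BdSmooth Γ →ₗ[ℂ] ℂ :=
  T ∘ₗ LinearMap.mulLeft ℂ χ

/-- A finite atlas `π_j : ℝ^{n-1} ↔ Γ_j` of the hypersurface `Γ`, with a smooth partition of unity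
`χ_j` such that `supp χ_j ⊆ Γ_j`. -/
structure BdAtlas {n : ℕ} (Γ : Set (Eu n)) where
  card : ℕ
  π : Fin card → Eu (n - 1) → Eu n
  smooth : ∀ j, ContDiff ℝ ∞ (π j)
  immersion : ∀ j y, Function.Injective (fderiv ℝ (π j) y)
  embedding : ∀ j, IsEmbedding (π j)
  isOpen : ∀ j, ∃ U : Set (Eu n), IsOpen U ∧ range (π j) = Γ ∩ U
  covers : ⋃ j, range (π j) = Γ
  χ : Fin card → BdSmooth Γ
  nonneg : ∀ j (x : Γ), 0 ≤ ((χ j).1 x).re ∧ ((χ j).1 x).im = 0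
  sum_eq_one : ∑ j, χ j = 1
  supp : ∀ j, ∀ x ∈ tsupport (χ j).1, (x : Eu n) ∈ range (π j)

/-- The density of the surface measure in the parametrization `π`. -/
def surfaceDensity {n d : ℕ} (π : Eu d → Eu n) (y : Eu d) : ℝ :=
  Real.sqrt ((ContinuousLinearMap.adjoint (fderiv ℝ π y) ∘L fderiv ℝ π y).det)

/-- `w` is the representation `(χT) ∘ π` of the distribution `χT` in the chart `π`. Functions `h` on
`Γ` are identified with the distributions `F ↦ ∫_Γ h F dS`; so `((χT) ∘ π)(ψ) = T(F)`, where
`F` vanishes off the range of `π` and `F(π(y)) J(y) = χ(π(y)) ψ(y)`, with `J` the density of the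
surface measure. -/
def IsChartRep {n : ℕ} {Γ : Set (Eu n)} (π : Eu (n - 1) → Eu n) (χ : BdSmooth Γ)
    (T : BdSmooth Γ →ₗ[ℂ] ℂ) (w : 𝓢'(Eu (n - 1), ℂ)) : Prop :=
  ∀ (ψ : 𝓢(Eu (n - 1), ℂ)) (F : BdSmooth Γ),
    (∀ (y : Eu (n - 1)) (x : Γ), (x : Eu n) = π y →
      F.1 x * (surfaceDensity π y : ℂ) = χ.1 x * ψ y) →
    (∀ x : Γ, (x : Eu n) ∉ range π → F.1 x = 0) →
      w ψ = T F

/-- `T ∈ H^α(Γ)`: the distribution `T` belongs to `H^α(ℝ^{n-1})` in local coordinates. (The space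
does not depend on the choice of the atlas and the partition of unity.) -/
def MemHBd {n : ℕ} {Γ : Set (Eu n)} (α : ℝ → ℝ) (T : BdSmooth Γ →ₗ[ℂ] ℂ) : Prop :=
  IsBdDistr T ∧ ∀ (𝔄 : BdAtlas Γ) (j : Fin 𝔄.card),
    ∃ w : 𝓢'(Eu (n - 1), ℂ), IsChartRep (𝔄.π j) (𝔄.χ j) T w ∧ MemH α w

/-- `T ∈ H^α_loc(Γ₀)` with `Γ₀ = Γ ∩ V`. -/
def MemHBdLoc {n : ℕ} {Γ : Set (Eu n)} (V : Set (Eu n)) (α : ℝ → ℝ)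
    (T : BdSmooth Γ →ₗ[ℂ] ℂ) : Prop :=
  IsBdDistr T ∧ ∀ χ : BdSmooth Γ, (∀ x ∈ tsupport χ.1, (x : Eu n) ∈ V) → MemHBd α (bdMul χ T)

/-! ### Elliptic boundary-value problems -/

/-- `D_k = i ∂/∂x_k`. -/
def Dpart {n : ℕ} (k : Fin n) (u : Eu n → ℂ) : Eu n → ℂ :=
  fun x => Complex.I * fderiv ℝ u x (EuclideanSpace.single k 1)

/-- `D^μ = D_1^{μ_1} ⋯ D_n^{μ_n}`. -/
def Dmulti {n : ℕ} (μ : Fin n → ℕ) (u : Eu n → ℂ) : Eu n → ℂ :=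
  (List.finRange n).foldr (fun k v => (Dpart k)^[μ k] v) u

/-- The multi-indices with `|μ| = k`. -/
def multiIdx (n k : ℕ) : Finset (Fin n → ℕ) := Finset.univ.piAntidiag k

/-- The differential operator `∑_{|μ| ≤ l} c_μ(x) D^μ`. -/
def diffOp {n : ℕ} (l : ℕ) (c : (Fin n → ℕ) → Eu n → ℂ) (u : Eu n → ℂ) : Eu n → ℂ :=
  fun x => ∑ k ∈ Finset.range (l + 1), ∑ μ ∈ multiIdx n k, c μ x * Dmulti μ u x

/-- The principal symbol `∑_{|μ| = l} c_μ(x) (ξ + τη)^μ`, as a polynomial in `τ`. -/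
def symbolPoly {n : ℕ} (l : ℕ) (c : (Fin n → ℕ) → Eu n → ℂ) (x ξ η : Eu n) : Polynomial ℂ :=
  ∑ μ ∈ multiIdx n l, Polynomial.C (c μ x) *
    ∏ k, (Polynomial.C (ξ k : ℂ) + Polynomial.C (η k : ℂ) * Polynomial.X) ^ μ k

/-- The roots with positive imaginary part, with multiplicity. -/
def upperRoots (P : Polynomial ℂ) : Multiset ℂ :=
  open Classical in P.roots.filter (fun τ => 0 < τ.im)

/-- The roots with negative imaginary part, with multiplicity. -/
def lowerRoots (P : Polynomial ℂ) : Multiset ℂ :=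
  open Classical in P.roots.filter (fun τ => τ.im < 0)

/-- The data of a boundary-value problem `Au = f` in `Ω`, `B_j u = g_j` on `Γ`, `j = 1,…,q`, with
`A = ∑_{|μ| ≤ 2q} a_μ D^μ` and `B_j = ∑_{|μ| ≤ m_j} b_{j,μ} D^μ`. -/
structure BVP (n q : ℕ) where
  a : (Fin n → ℕ) → Eu n → ℂ
  m : Fin q → ℕ
  b : Fin q → (Fin n → ℕ) → Eu n → ℂ

namespace BVP

variable {n q : ℕ} (P : BVP n q)

/-- The operator `A`. -/
def A (u : Eu n → ℂ) : Eu n → ℂ := diffOp (2 * q) P.a u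

/-- The operator `B_j`. -/
def B (j : Fin q) (u : Eu n → ℂ) : Eu n → ℂ := diffOp (P.m j) (P.b j) u

/-- `m = max {m_1, …, m_q}`. -/
def maxOrder : ℕ := Finset.univ.sup P.m

/-- `A` is properly elliptic on `Ω̄`: for linearly independent `ξ`, `η`, the polynomial
`A⁰(x, ξ + τη)` in `τ` has `q` roots with positive and `q` roots with negative imaginary part. -/
def ProperlyElliptic (Ω : Opens (Eu n)) : Prop :=
  ∀ x ∈ closure (Ω : Set (Eu n)), ∀ ξ η : Eu n, LinearIndependent ℝ ![ξ, η] →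
    (upperRoots (symbolPoly (2 * q) P.a x ξ η)).card = q ∧
    (lowerRoots (symbolPoly (2 * q) P.a x ξ η)).card = q

/-- The Lopatynsky condition: for every `x ∈ Γ` and every tangent vector `ξ ≠ 0`, the polynomials
`B_j⁰(x, ξ + τν(x))` in `τ` are linearly independent modulo `∏ (τ - τ_k)`, where `τ_k` are the roots
of `A⁰(x, ξ + τν(x))` with positive imaginary part. -/
def Lopatynsky (Ω : Opens (Eu n)) : Prop :=
  ∀ x ∈ frontier (Ω : Set (Eu n)), ∀ ν : Eu n, IsInwardNormal Ω x ν →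
    ∀ ξ : Eu n, ξ ≠ 0 → ⟪ξ, ν⟫_ℝ = 0 → ∀ c : Fin q → ℂ,
      (((upperRoots (symbolPoly (2 * q) P.a x ξ ν)).map
          (fun τ => Polynomial.X - Polynomial.C τ)).prod ∣
        ∑ j, Polynomial.C (c j) * symbolPoly (P.m j) (P.b j) x ξ ν) → c = 0

/-- The boundary-value problem has smooth coefficients and is elliptic in `Ω`. -/
structure IsElliptic (Ω : Opens (Eu n)) : Prop where
  smooth_a : ∀ μ, SmoothOn (closure (Ω : Set (Eu n))) (P.a μ)
  smooth_b : ∀ j μ, SmoothOn (frontier (Ω : Set (Eu n))) (P.b j μ)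
  order_le : ∀ j, P.m j ≤ 2 * q - 1
  properlyElliptic : P.ProperlyElliptic Ω
  lopatynsky : P.Lopatynsky Ω

/-- `(f, g) = (A, B)u` for `u ∈ H^{m+1/2+}(Ω)`, where `(A, B)` is extended by continuity from
`C^∞(Ω̄)`: for some `α ∈ RO` with `σ₀(α) > m + 1/2` and `u ∈ H^α(Ω)` there are `u_k ∈ C^∞(Ω̄)` such
that `u_k → u` in `H^α(Ω)`, `A u_k → f` in `𝓓'(Ω)` and `B_j u_k → g_j` in `𝓓'(Γ)`. -/
def IsImage (Ω : Opens (Eu n)) (u f : Distr Ω)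
    (g : Fin q → BdSmooth (frontier (Ω : Set (Eu n))) →ₗ[ℂ] ℂ) : Prop :=
  (∀ j, IsBdDistr (g j)) ∧
  ∃ α : ℝ → ℝ, IsRO α ∧ (P.maxOrder : ℝ) + 1 / 2 < lowerIndex α ∧ MemHDomain Ω α u ∧
    ∃ v : ℕ → Eu n → ℂ, (∀ k, ContDiff ℝ ∞ (v k)) ∧
      Tendsto (fun k => hNormDomain Ω α (fun ψ => ofFun Ω (v k) ψ - u ψ)) atTop (𝓝 0) ∧
      (∀ ψ : 𝓓(Ω, ℂ), Tendsto (fun k => ofFun Ω (P.A (v k)) ψ) atTop (𝓝 (f ψ))) ∧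
      ∀ (j : Fin q) (F : BdSmooth (frontier (Ω : Set (Eu n)))),
        Tendsto (fun k => ∫ x : frontier (Ω : Set (Eu n)), P.B j (v k) x * F.1 x
            ∂(Measure.euclideanHausdorffMeasure (n - 1)))
          atTop (𝓝 (g j F))

end BVP

end ExtendedSobolev

end

open ExtendedSobolev

/-!
The proof is by contraposition and takes place in the interior: if the integral diverges, there is a
`u ∈ H^φ(Ω)` with compact support in `Ω ∩ V` that is not of class `C^p` there. Since `u` vanishes near
`Γ`, all boundary data `B_j u` are zero, and since `A` has order `2q`, the distribution `Au` belongs to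
`H^{φρ^{-2q}}` (`MemHContLoc.tdDiffOp`, `MemHContLoc.memHLoc`), so that `u` contradicts the
implication.

Write `t_k = 2^{k+k₀}`. The function is a lacunary series of bumps at one point `x₀ ∈ Ω ∩ V`,
`u(x) = ∑ c_k θ(t_k (x - x₀))`, `c_k = b_k t_k^{n/2} / φ(t_k)`, where `θ` is smooth, equals `y_i^p` in
the unit ball and vanishes for `|y| ≥ 3/2`.

* The `k`-th bump has a Fourier transform of size `t_k^{-n}` that lives on the frequencies `|ξ| ≲ t_k`
  and decays rapidly beyond (`exists_fourier_lump_le`). As `φ` grows faster than `t^{1/2}` and at most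
  polynomially, the bumps, normalized by the factor `t_k^{n/2} / φ(t_k)`, are almost orthogonal in
  `H^φ`, and `‖u‖² ≤ C ∑ b_k²` (`exists_weightedSq_tsum_le`). The same bound for the remainders shows
  that the smooth partial sums converge to `u` in `H^φ` (`exists_lump_series_tendsto`).
* On the annulus `3/4 < t_N |x - x₀| < 1` exactly the bumps with `k ≤ N` are present and each is
  a monomial, so `u(x) = (∑_{k ≤ N} c_k t_k^p) (x - x₀)_i^p` there (`eq_monomial_on_annulus`). If
  `u` were `C^p` near `x₀`, its `p`-th derivative in the direction `e_i` would be `p! ∑_{k ≤ N} c_k t_k^p`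
  at points of the annuli, which tend to `x₀`. Hence `u` is not `C^p` when these sums tend to infinity
  (`not_contDiffAt_of_eqOn_annuli`).
* With `a_k = t_k^{p+n/2} / φ(t_k)` the sums are `∑_{k ≤ N} a_k b_k`. Comparison of the integral with
  its dyadic sums shows that divergence of the integral means `∑ a_k² = ∞`
  (`integrableOn_of_summable_dyadic`), and then the Abel–Dini theorem supplies a `b ∈ ℓ²` with
  `∑ a_k b_k = ∞` (`exists_summable_sq_tendsto_sum_mul_atTop`).
-/

namespace ExtendedSobolev

/-! ### Growth of RO-varying functions -/

/-- An RO-varying function grows at most polynomially, uniformly in the base point. -/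
lemma IsRO.exists_le_mul_pow {α : ℝ → ℝ} (h : IsRO α) :
    ∃ K : ℕ, ∃ C > (0 : ℝ), ∀ t ≥ (1 : ℝ), ∀ l ≥ (1 : ℝ), α (l * t) ≤ C * l ^ K * α t := by
  obtain ⟨b, hb, c, hc, hbc⟩ := h.bounded
  have step : ∀ t ≥ (1 : ℝ), ∀ l ∈ Icc 1 b, α (l * t) ≤ c * α t := fun t ht l hl =>
    (div_le_iff₀ (h.pos t ht)).1 (hbc t ht l hl).2
  have iter : ∀ m : ℕ, ∀ t ≥ (1 : ℝ), ∀ l ∈ Icc 1 (b ^ m), α (l * t) ≤ c ^ m * α t := by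
    intro m
    induction m with
    | zero =>
      intro t ht l hl
      have : l = 1 := le_antisymm (by simpa using hl.2) hl.1
      simp [this]
    | succ m ih =>
      intro t ht l hl
      rcases le_total l b with hlb | hlb
      · refine (step t ht l ⟨hl.1, hlb⟩).trans ?_
        gcongr
        · exact (h.pos t ht).le
        · exact le_self_pow₀ hc (Nat.succ_ne_zero m)
      · have hb0 : 0 < b := by linarith
        have h1 : 1 ≤ l / b := (one_le_div hb0).2 hlb
        have h2 : l / b ≤ b ^ m := by
          rw [div_le_iff₀ hb0, ← pow_succ]
          exact hl.2
        have h3 : 1 ≤ l / b * t := one_le_mul_of_one_le_of_one_le h1 ht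
        have h4 := step (l / b * t) h3 b ⟨hb.le, le_rfl⟩
        have h5 := ih t ht (l / b) ⟨h1, h2⟩
        have h6 : b * (l / b * t) = l * t := by field_simp
        rw [h6] at h4
        calc α (l * t) ≤ c * α (l / b * t) := h4
          _ ≤ c * (c ^ m * α t) := by gcongr
          _ = c ^ (m + 1) * α t := by ring
  obtain ⟨K, hK⟩ := pow_unbounded_of_one_lt c hb
  refine ⟨K, c, by linarith, fun t ht l hl => ?_⟩
  obtain ⟨m, hm1, hm2⟩ := exists_nat_pow_near hl hb
  have h0 := (h.pos t ht).le
  calc α (l * t) ≤ c ^ (m + 1) * α t := iter (m + 1) t ht l ⟨hl, hm2.le⟩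
    _ = c * c ^ m * α t := by ring
    _ ≤ c * (b ^ K) ^ m * α t := by gcongr
    _ = c * (b ^ m) ^ K * α t := by rw [← pow_mul, ← pow_mul, mul_comm K m]
    _ ≤ c * l ^ K * α t := by
      have : 0 ≤ b ^ m := by positivity
      gcongr

lemma exists_mul_rpow_le_of_lt_lowerIndex {α : ℝ → ℝ} (h : IsRO α) {r : ℝ} (hr : 0 ≤ r)
    (hα : r < lowerIndex α) :
    ∃ c > (0 : ℝ), ∀ t ≥ (1 : ℝ), ∀ l ≥ (1 : ℝ), c * l ^ r * α t ≤ α (l * t) := by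
  unfold lowerIndex at hα
  obtain ⟨s, ⟨c, hc, hs⟩, hrs⟩ := exists_lt_of_lt_csSup (by
    by_contra hne
    rw [not_nonempty_iff_eq_empty] at hne
    rw [hne, Real.sSup_empty] at hα
    linarith) hα
  refine ⟨c, hc, fun t ht l hl => ?_⟩
  have := hs t ht l hl
  rw [le_div_iff₀ (h.pos t ht)] at this
  refine le_trans ?_ this
  have h0 := (h.pos t ht).le
  gcongr

/-- If the dyadic sums converge, so does the integral: `α` is bounded below on `[s, 2s]` by a
multiple of `α s`. -/
lemma integrableOn_of_summable_dyadic {α : ℝ → ℝ} (h : IsRO α) (hα : 0 < lowerIndex α) (N k₀ : ℕ)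
    (hs : Summable fun k : ℕ => ((2 : ℝ) ^ (k + k₀)) ^ (N + 1) / α (2 ^ (k + k₀)) ^ 2) :
    IntegrableOn (fun t : ℝ => t ^ N * (α t ^ 2)⁻¹) (Ioi 1) := by
  obtain ⟨c, hc, hlow⟩ := exists_mul_rpow_le_of_lt_lowerIndex h le_rfl hα
  have hbound : ∀ s ≥ (1 : ℝ), ∀ T, ∀ t ∈ Icc s T,
      ‖t ^ N * (α t ^ 2)⁻¹‖ ≤ T ^ N * ((c * α s) ^ 2)⁻¹ := by
    intro s hs1 T t ht
    have hs0 : 0 < s := by linarith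
    have h1 := hlow s hs1 (t / s) ((one_le_div hs0).2 ht.1)
    have h2 : t / s * s = t := by field_simp
    rw [h2, Real.rpow_zero, mul_one] at h1
    have h3 := h.pos s hs1
    have h5 : 0 ≤ t := hs0.le.trans ht.1
    have h6 : 0 ≤ T := h5.trans ht.2
    rw [Real.norm_of_nonneg (by positivity)]
    have h4 : 0 < c * α s := by positivity
    have := ht.2
    gcongr
  have hmeas : AEStronglyMeasurable (fun t : ℝ => t ^ N * (α t ^ 2)⁻¹)
      (volume.restrict (Ici 1)) := by
    have h1 : AEMeasurable α (volume.restrict (Ici (1 : ℝ))) :=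
      aemeasurable_restrict_of_measurable_subtype measurableSet_Ici h.measurable
    exact ((measurable_id.pow_const N).aemeasurable.mul
      ((h1.pow_const 2).inv)).aestronglyMeasurable
  have hint : ∀ s ≥ (1 : ℝ), ∀ T, IntegrableOn (fun t : ℝ => t ^ N * (α t ^ 2)⁻¹) (Icc s T) := by
    intro s hs1 T
    refine IntegrableOn.of_bound (by simp) ?_ (T ^ N * ((c * α s) ^ 2)⁻¹) ?_
    · exact hmeas.mono_measure
        (Measure.restrict_mono (fun t (ht : t ∈ Icc s T) => hs1.le.trans ht.1) le_rfl)
    · exact (ae_restrict_iff' measurableSet_Icc).2 (ae_of_all _ (hbound s hs1 T))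
  have ht1 : ∀ k : ℕ, (1 : ℝ) ≤ 2 ^ (k + k₀) := fun k => one_le_pow₀ (by norm_num)
  have hU : IntegrableOn (fun t : ℝ => t ^ N * (α t ^ 2)⁻¹)
      (⋃ k : ℕ, Icc ((2 : ℝ) ^ (k + k₀)) (2 * 2 ^ (k + k₀))) := by
    refine integrableOn_iUnion_of_summable_integral_norm (fun k => hint _ (ht1 k) _) ?_
    refine Summable.of_nonneg_of_le (fun k => by positivity) (fun k => ?_)
      (hs.mul_left (2 ^ N * (c ^ 2)⁻¹))
    have hpos := h.pos _ (ht1 k)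
    set T : ℝ := 2 ^ (k + k₀)
    have := norm_setIntegral_le_of_norm_le_const
      (μ := volume) (s := Icc T (2 * T)) (f := fun t : ℝ => ‖t ^ N * (α t ^ 2)⁻¹‖)
      (C := (2 * T) ^ N * ((c * α T) ^ 2)⁻¹) (by simp)
      (fun t ht => by rw [norm_norm]; exact hbound T (ht1 k) (2 * T) t ht)
    refine ((le_abs_self _).trans this).trans (le_of_eq ?_)
    have hT : 0 ≤ T := by linarith [ht1 k]
    rw [Real.volume_real_Icc_of_le (by linarith)]
    field_simp
    ring
  refine (hU.union (hint 1 le_rfl (2 ^ k₀))).mono_set ?_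
  intro t (ht : 1 < t)
  by_cases hle : t ≤ 2 ^ k₀
  · exact Or.inr ⟨ht.le, hle⟩
  · left
    push Not at hle
    have h2 : (0 : ℝ) < 2 ^ k₀ := by positivity
    obtain ⟨m, hm1, hm2⟩ := exists_nat_pow_near ((one_le_div h2).2 hle.le) one_lt_two
    refine mem_iUnion.2 ⟨m, ?_, ?_⟩
    · rw [pow_add]; exact (le_div_iff₀ h2).1 hm1
    · rw [pow_add, ← mul_assoc, ← pow_succ']; exact ((div_lt_iff₀ h2).1 hm2).le

/-- The Abel–Dini theorem, in the form of a failure of duality: if `a ∉ ℓ²`, then `∑ aₖ bₖ = ∞` for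
some `b ∈ ℓ²`. -/
lemma exists_summable_sq_tendsto_sum_mul_atTop {a : ℕ → ℝ} (ha : ∀ k, 0 < a k)
    (hs : ¬ Summable fun k => a k ^ 2) :
    ∃ b : ℕ → ℝ, (Summable fun k => b k ^ 2) ∧
      Tendsto (fun N => ∑ k ∈ Finset.range N, a k * b k) atTop atTop := by
  set A : ℕ → ℝ := fun N => ∑ k ∈ Finset.range N, a k ^ 2 with hA
  have hAs : ∀ N, A (N + 1) = A N + a N ^ 2 := fun N => Finset.sum_range_succ _ _
  have hA0 : ∀ N, 0 < A (N + 1) := fun N =>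
    Finset.sum_pos (fun k _ => pow_pos (ha k) 2) (by simp)
  have hAmono : Monotone A := monotone_nat_of_le_succ fun N => by
    rw [hAs]; linarith [sq_nonneg (a N)]
  have hAtop : Tendsto A atTop atTop :=
    (not_summable_iff_tendsto_nat_atTop_of_nonneg fun k => sq_nonneg (a k)).1 hs
  refine ⟨fun k => a k / A (k + 1), ?_, ?_⟩
  · refine summable_of_sum_range_le (c := 2 / a 0 ^ 2) (fun k => sq_nonneg _) fun N => ?_
    -- telescoping: `aₖ² / Aₖ² ≤ 1 / Aₖ₋₁ - 1 / Aₖ`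
    have key : ∀ N, ∑ k ∈ Finset.range (N + 1), (a k / A (k + 1)) ^ 2 ≤
        2 / a 0 ^ 2 - 1 / A (N + 1) := by
      intro N
      induction N with
      | zero =>
        have h0 := ha 0
        have : A 1 = a 0 ^ 2 := by simp [hA]
        simp only [zero_add, Finset.sum_range_one, this]
        apply le_of_eq
        field_simp
        ring
      | succ N ih =>
        rw [Finset.sum_range_succ]
        have h1 := hA0 N
        have h2 := hA0 (N + 1)
        have h3 := hAs (N + 1)
        have h4 : A (N + 1) ≤ A (N + 1 + 1) := hAmono (Nat.le_succ _)
        have h5 : (a (N + 1) / A (N + 1 + 1)) ^ 2 ≤ 1 / A (N + 1) - 1 / A (N + 1 + 1) := by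
          have h6 : 1 / A (N + 1) - 1 / A (N + 1 + 1) =
              a (N + 1) ^ 2 / (A (N + 1) * A (N + 1 + 1)) := by
            rw [div_sub_div _ _ h1.ne' h2.ne']
            congr 1
            linarith
          rw [h6, div_pow, pow_two (A _)]
          gcongr
        linarith
    refine (Finset.sum_le_sum_of_subset_of_nonneg (Finset.range_mono (Nat.le_succ N))
      fun k _ _ => sq_nonneg _).trans ((key N).trans ?_)
    have := hA0 N
    have : 0 < 1 / A (N + 1) := by positivity
    linarith
  · have hnn : ∀ k, 0 ≤ a k * (a k / A (k + 1)) := fun k =>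
      mul_nonneg (ha k).le (div_nonneg (ha k).le (hA0 k).le)
    rw [← not_summable_iff_tendsto_nat_atTop_of_nonneg hnn]
    intro hsum
    obtain ⟨S, hS⟩ := hsum
    have hlim := hS.tendsto_sum_nat
    obtain ⟨M, hM⟩ := (hlim.eventually (lt_mem_nhds (show S - 1 / 2 < S by linarith))).exists
    obtain ⟨N, hN1, hN2⟩ := ((hAtop.eventually_ge_atTop (2 * A (M + 1))).and
      (eventually_ge_atTop (M + 1))).exists
    have hNpos : 0 < A N := (hA0 M).trans_le (hAmono hN2)
    have hle : ∑ k ∈ Finset.range N, a k * (a k / A (k + 1)) ≤ S :=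
      sum_le_hasSum _ (fun k _ => hnn k) hS
    have hsplit := Finset.sum_range_add_sum_Ico (fun k => a k * (a k / A (k + 1)))
      ((Nat.le_succ M).trans hN2)
    have hsplitA := Finset.sum_range_add_sum_Ico (fun k => a k ^ 2) ((Nat.le_succ M).trans hN2)
    have htail : (∑ k ∈ Finset.Ico M N, a k ^ 2) / A N ≤
        ∑ k ∈ Finset.Ico M N, a k * (a k / A (k + 1)) := by
      rw [Finset.sum_div]
      refine Finset.sum_le_sum fun k hk => ?_
      have h1 : A (k + 1) ≤ A N := hAmono (Finset.mem_Ico.1 hk).2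
      have h2 := hA0 k
      rw [← mul_div_assoc, ← pow_two]
      gcongr
    have hAM : A M ≤ A (M + 1) := hAmono (Nat.le_succ M)
    have hhalf : 1 / 2 ≤ (∑ k ∈ Finset.Ico M N, a k ^ 2) / A N := by
      rw [le_div_iff₀ hNpos]
      have : A M + ∑ k ∈ Finset.Ico M N, a k ^ 2 = A N := hsplitA
      linarith
    linarith

open scoped LineDeriv

/-! ### Tempered distributions with a continuous Fourier transform -/

/-- The tempered distribution `w` has the Fourier transform `g`, where `g` is continuous and its
products with Schwartz functions are integrable. The latter makes the integrals `∫ g ψ` additive in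
`g`, which local integrability alone does not. -/
structure HasContFourier {d : ℕ} (w : 𝓢'(Eu d, ℂ)) (g : Eu d → ℂ) : Prop where
  cont : Continuous g
  integrable : ∀ ψ : 𝓢(Eu d, ℂ), Integrable (fun ξ => g ξ * ψ ξ)
  fourier_eq : ∀ ψ : 𝓢(Eu d, ℂ), (𝓕 w : 𝓢'(Eu d, ℂ)) ψ = ∫ ξ, g ξ * ψ ξ

/-- The elements of `H^α(ℝᵈ)` whose Fourier transform is a function as in `HasContFourier`. -/
def MemHCont {d : ℕ} (α : ℝ → ℝ) (w : 𝓢'(Eu d, ℂ)) : Prop :=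
  ∃ g : Eu d → ℂ, HasContFourier w g ∧ weightedSq α g < ⊤

variable {d : ℕ} {α : ℝ → ℝ} {w w₁ w₂ : 𝓢'(Eu d, ℂ)} {g g₁ g₂ : Eu d → ℂ}

lemma HasContFourier.hasFourierFunction (h : HasContFourier w g) : HasFourierFunction w g :=
  ⟨h.cont.locallyIntegrable, h.fourier_eq⟩

lemma MemHCont.memH (h : MemHCont α w) : MemH α w :=
  let ⟨g, hg, hα⟩ := h
  ⟨g, hg.hasFourierFunction, hα⟩

lemma HasContFourier.add (h₁ : HasContFourier w₁ g₁) (h₂ : HasContFourier w₂ g₂) :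
    HasContFourier (w₁ + w₂) (fun ξ => g₁ ξ + g₂ ξ) where
  cont := h₁.cont.add h₂.cont
  integrable ψ := by
    simp_rw [add_mul]
    exact (h₁.integrable ψ).add (h₂.integrable ψ)
  fourier_eq ψ := by
    simp_rw [add_mul]
    rw [integral_add (h₁.integrable ψ) (h₂.integrable ψ), ← h₁.fourier_eq, ← h₂.fourier_eq]
    rfl

lemma HasContFourier.const_smul (h : HasContFourier w g) (c : ℂ) :
    HasContFourier (c • w) (fun ξ => c * g ξ) where
  cont := continuous_const.mul h.cont
  integrable ψ := by simpa [mul_assoc] using (h.integrable ψ).const_mul c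
  fourier_eq ψ := by
    simp_rw [mul_assoc]
    rw [integral_const_mul, ← h.fourier_eq]
    rfl

/-- Differentiation in the direction `m` multiplies the Fourier transform by `2πi⟨ξ, m⟩`. -/
lemma HasContFourier.lineDeriv (h : HasContFourier w g) (m : Eu d) :
    HasContFourier (∂_{m} w) (fun ξ => 2 * Real.pi * Complex.I * ((⟪ξ, m⟫_ℝ : ℝ) : ℂ) * g ξ) := by
  have hg : (fun ξ : Eu d => ((⟪ξ, m⟫_ℝ : ℝ) : ℂ)).HasTemperateGrowth := by fun_prop
  have key : ∀ (ψ : 𝓢(Eu d, ℂ)) (ξ : Eu d),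
      2 * Real.pi * Complex.I * ((⟪ξ, m⟫_ℝ : ℝ) : ℂ) * g ξ * ψ ξ =
        2 * Real.pi * Complex.I *
          (g ξ * SchwartzMap.smulLeftCLM ℂ (fun ξ : Eu d => ((⟪ξ, m⟫_ℝ : ℝ) : ℂ)) ψ ξ) := by
    intro ψ ξ
    rw [SchwartzMap.smulLeftCLM_apply_apply hg, smul_eq_mul]
    ring
  refine ⟨?_, fun ψ => ?_, fun ψ => ?_⟩
  · have := h.cont
    fun_prop
  · simp_rw [key]
    exact (h.integrable _).const_mul _
  · simp_rw [key]
    rw [integral_const_mul, ← h.fourier_eq, TemperedDistribution.fourier_lineDerivOp_eq]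
    rfl

/-! ### Elementary properties of the weighted norms -/

lemma one_le_sqrt_one_add_sq (ξ : Eu d) : 1 ≤ Real.sqrt (1 + ‖ξ‖ ^ 2) := by
  rw [Real.one_le_sqrt]
  linarith [sq_nonneg ‖ξ‖]

lemma norm_le_sqrt_one_add_sq (ξ : Eu d) : ‖ξ‖ ≤ Real.sqrt (1 + ‖ξ‖ ^ 2) :=
  Real.le_sqrt_of_sq_le (by linarith)

lemma IsRO.measurable_mulRho_weight (h : IsRO α) (r : ℝ) :
    Measurable (fun ξ : Eu d => mulRho α r (Real.sqrt (1 + ‖ξ‖ ^ 2))) := by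
  have h0 : Measurable (fun ξ : Eu d => Real.sqrt (1 + ‖ξ‖ ^ 2)) := by fun_prop
  have h1 : Measurable (fun ξ : Eu d => α (Real.sqrt (1 + ‖ξ‖ ^ 2))) :=
    h.measurable.comp (h0.subtype_mk (h := fun ξ => one_le_sqrt_one_add_sq ξ))
  exact h1.mul (h0.pow_const r)

lemma weightedSq_add_lt_top (h : IsRO α) {r : ℝ} (hc : Continuous g₁)
    (h₁ : weightedSq (mulRho α r) g₁ < ⊤) (h₂ : weightedSq (mulRho α r) g₂ < ⊤) :
    weightedSq (mulRho α r) (fun ξ => g₁ ξ + g₂ ξ) < ⊤ := by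
  have hle : weightedSq (mulRho α r) (fun ξ => g₁ ξ + g₂ ξ) ≤
      ∫⁻ ξ, (2 * ENNReal.ofReal (mulRho α r (Real.sqrt (1 + ‖ξ‖ ^ 2)) ^ 2 * ‖g₁ ξ‖ ^ 2) +
        2 * ENNReal.ofReal (mulRho α r (Real.sqrt (1 + ‖ξ‖ ^ 2)) ^ 2 * ‖g₂ ξ‖ ^ 2)) := by
    refine lintegral_mono fun ξ => ?_
    have h2 : ∀ x : ℝ, 2 * ENNReal.ofReal x = ENNReal.ofReal (2 * x) := fun x => by
      rw [ENNReal.ofReal_mul (by norm_num)]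
      simp
    rw [h2, h2, ← ENNReal.ofReal_add (by positivity) (by positivity)]
    refine ENNReal.ofReal_le_ofReal ?_
    have h3 : ‖g₁ ξ + g₂ ξ‖ ^ 2 ≤ 2 * ‖g₁ ξ‖ ^ 2 + 2 * ‖g₂ ξ‖ ^ 2 := by
      have := norm_add_le (g₁ ξ) (g₂ ξ)
      nlinarith [norm_nonneg (g₁ ξ + g₂ ξ), sq_nonneg (‖g₁ ξ‖ - ‖g₂ ξ‖)]
    nlinarith [sq_nonneg (mulRho α r (Real.sqrt (1 + ‖ξ‖ ^ 2)))]
  refine hle.trans_lt ?_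
  have hm := h.measurable_mulRho_weight (d := d) r
  rw [lintegral_add_left (by fun_prop), lintegral_const_mul' _ _ (by simp),
    lintegral_const_mul' _ _ (by simp)]
  exact ENNReal.add_lt_top.2 ⟨ENNReal.mul_lt_top (by simp) h₁, ENNReal.mul_lt_top (by simp) h₂⟩

/-- A pointwise bound of the weighted functions gives a bound of the weighted norms. -/
lemma weightedSq_lt_top_of_le {β : ℝ → ℝ} {C : ℝ}
    (hle : ∀ ξ : Eu d, |β (Real.sqrt (1 + ‖ξ‖ ^ 2))| * ‖g₂ ξ‖ ≤
      C * (|α (Real.sqrt (1 + ‖ξ‖ ^ 2))| * ‖g₁ ξ‖))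
    (h₁ : weightedSq α g₁ < ⊤) : weightedSq β g₂ < ⊤ := by
  have : weightedSq β g₂ ≤ ENNReal.ofReal (C ^ 2) * weightedSq α g₁ := by
    unfold weightedSq
    rw [← lintegral_const_mul' _ _ (by simp)]
    refine lintegral_mono fun ξ => ?_
    rw [← ENNReal.ofReal_mul (by positivity)]
    refine ENNReal.ofReal_le_ofReal ?_
    have := pow_le_pow_left₀ (by positivity) (hle ξ) 2
    simpa only [mul_pow, sq_abs] using this
  exact this.trans_lt (ENNReal.mul_lt_top (by simp) h₁)

/-! ### The scale `H^{αρ^{-s}}` -/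

lemma MemHCont.zero : MemHCont α (0 : 𝓢'(Eu d, ℂ)) := by
  refine ⟨fun _ => 0, ⟨continuous_const, fun ψ => by simp, fun ψ => ?_⟩, by simp [weightedSq]⟩
  simp

lemma MemHCont.add (h : IsRO α) {r : ℝ} (h₁ : MemHCont (mulRho α r) w₁)
    (h₂ : MemHCont (mulRho α r) w₂) : MemHCont (mulRho α r) (w₁ + w₂) :=
  let ⟨_, hg₁, hα₁⟩ := h₁
  let ⟨_, hg₂, hα₂⟩ := h₂
  ⟨_, hg₁.add hg₂, weightedSq_add_lt_top h hg₁.cont hα₁ hα₂⟩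

lemma MemHCont.const_smul (h : MemHCont α w) (c : ℂ) : MemHCont α (c • w) := by
  obtain ⟨g, hg, hα⟩ := h
  refine ⟨_, hg.const_smul c, weightedSq_lt_top_of_le (C := ‖c‖) (fun ξ => le_of_eq ?_) hα⟩
  rw [norm_mul]
  ring

lemma MemHCont.mono_exponent {s s' : ℕ} (hs : s ≤ s') (h : MemHCont (mulRho α (-(s : ℝ))) w) :
    MemHCont (mulRho α (-(s' : ℝ))) w := by
  obtain ⟨g, hg, hα⟩ := h
  refine ⟨g, hg, weightedSq_lt_top_of_le (C := 1) (fun ξ => ?_) hα⟩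
  rw [one_mul, mulRho, mulRho, abs_mul, abs_mul]
  have h1 := one_le_sqrt_one_add_sq ξ
  have h2 : (s : ℝ) ≤ s' := by exact_mod_cast hs
  rw [abs_of_nonneg (by positivity : 0 ≤ Real.sqrt (1 + ‖ξ‖ ^ 2) ^ (-(s : ℝ))),
    abs_of_nonneg (by positivity : 0 ≤ Real.sqrt (1 + ‖ξ‖ ^ 2) ^ (-(s' : ℝ)))]
  gcongr

lemma MemHCont.lineDeriv {s : ℕ} (h : MemHCont (mulRho α (-(s : ℝ))) w) (m : Eu d) :
    MemHCont (mulRho α (-((s + 1 : ℕ) : ℝ))) (∂_{m} w) := by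
  obtain ⟨g, hg, hα⟩ := h
  refine ⟨_, hg.lineDeriv m,
    weightedSq_lt_top_of_le (C := 2 * Real.pi * ‖m‖) (fun ξ => ?_) hα⟩
  have h1 := one_le_sqrt_one_add_sq ξ
  set R := Real.sqrt (1 + ‖ξ‖ ^ 2) with hR
  have h0 : 0 < R := by linarith
  have h2 : R ^ (-((s + 1 : ℕ) : ℝ)) * R = R ^ (-(s : ℝ)) := by
    rw [← Real.rpow_add_one h0.ne']
    push_cast
    congr 1
    ring
  have h3 : |⟪ξ, m⟫_ℝ| ≤ R * ‖m‖ := (abs_real_inner_le_norm ξ m).trans (by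
    gcongr
    exact norm_le_sqrt_one_add_sq ξ)
  have h4 : ‖2 * (Real.pi : ℂ) * Complex.I * ((⟪ξ, m⟫_ℝ : ℝ) : ℂ) * g ξ‖ =
      2 * Real.pi * |⟪ξ, m⟫_ℝ| * ‖g ξ‖ := by
    simp [abs_of_pos Real.pi_pos]
  rw [h4, mulRho, mulRho, abs_mul, abs_mul, ← h2, abs_mul, abs_of_pos h0]
  calc |α R| * |R ^ (-((s + 1 : ℕ) : ℝ))| * (2 * Real.pi * |⟪ξ, m⟫_ℝ| * ‖g ξ‖)
      ≤ |α R| * |R ^ (-((s + 1 : ℕ) : ℝ))| * (2 * Real.pi * (R * ‖m‖) * ‖g ξ‖) := by gcongr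
    _ = _ := by ring

/-! ### Local spaces and differential operators -/

/-- `w` belongs to `H^{αρ^{-s}}` locally: all its products with functions from `C₀^∞(ℝᵈ)` do. -/
def MemHContLoc {d : ℕ} (α : ℝ → ℝ) (s : ℕ) (w : 𝓢'(Eu d, ℂ)) : Prop :=
  ∀ S : Eu d → ℂ, ContDiff ℝ ∞ S → HasCompactSupport S →
    MemHCont (mulRho α (-(s : ℝ))) (TemperedDistribution.smulLeftCLM ℂ S w)

lemma MemHContLoc.mono {s s' : ℕ} (hs : s ≤ s') (h : MemHContLoc α s w) : MemHContLoc α s' w :=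
  fun S hS hS' => (h S hS hS').mono_exponent hs

/-- The Leibniz rule `S ∂w = ∂(S w) - (∂S) w` in the space of tempered distributions. -/
lemma smulLeftCLM_lineDeriv (w : 𝓢'(Eu d, ℂ)) {S : Eu d → ℂ} (hS : ContDiff ℝ ∞ S)
    (hS' : HasCompactSupport S) (m : Eu d) :
    TemperedDistribution.smulLeftCLM ℂ S (∂_{m} w) =
      ∂_{m} (TemperedDistribution.smulLeftCLM ℂ S w) +
        (-1 : ℂ) • TemperedDistribution.smulLeftCLM ℂ (fun x => fderiv ℝ S x m) w := by
  have hT := hS'.hasTemperateGrowth hS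
  have hS1 : ContDiff ℝ ∞ (fun x => fderiv ℝ S x m) :=
    (hS.fderiv_right (m := ∞) (by simp)).clm_apply contDiff_const
  have hT1 : (fun x => fderiv ℝ S x m).HasTemperateGrowth :=
    (hS'.fderiv_apply ℝ m).hasTemperateGrowth hS1
  ext ψ
  have key : -∂_{m} (SchwartzMap.smulLeftCLM ℂ S ψ) =
      SchwartzMap.smulLeftCLM ℂ S (-∂_{m} ψ) +
        (-1 : ℂ) • SchwartzMap.smulLeftCLM ℂ (fun x => fderiv ℝ S x m) ψ := by
    ext x
    have hd : HasFDerivAt (SchwartzMap.smulLeftCLM ℂ S ψ)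
        (S x • fderiv ℝ ψ x + ψ x • fderiv ℝ S x) x := by
      have h1 : (SchwartzMap.smulLeftCLM ℂ S ψ : Eu d → ℂ) = fun y => S y * ψ y := by
        ext y
        rw [SchwartzMap.smulLeftCLM_apply_apply hT, smul_eq_mul]
      rw [h1]
      exact ((hS.differentiable (by simp)) x).hasFDerivAt.mul (ψ.differentiableAt.hasFDerivAt)
    simp only [neg_apply, add_apply, smul_apply,
      SchwartzMap.lineDerivOp_apply_eq_fderiv, SchwartzMap.smulLeftCLM_apply_apply hT,
      SchwartzMap.smulLeftCLM_apply_apply hT1, hd.fderiv, smul_eq_mul]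
    ring
  have h2 : ∀ u : 𝓢(Eu d, ℂ), (∂_{m} w) u = w (-∂_{m} u) := fun u => rfl
  have h3 : (∂_{m} (TemperedDistribution.smulLeftCLM ℂ S w)) ψ =
    w (SchwartzMap.smulLeftCLM ℂ S (-∂_{m} ψ)) := rfl
  change (∂_{m} w) (SchwartzMap.smulLeftCLM ℂ S ψ) =
    (∂_{m} (TemperedDistribution.smulLeftCLM ℂ S w)) ψ +
      (-1 : ℂ) • w (SchwartzMap.smulLeftCLM ℂ (fun x => fderiv ℝ S x m) ψ)
  rw [h2, key, h3, map_add, map_smul]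

lemma MemHContLoc.lineDeriv (h : IsRO α) {s : ℕ} (hw : MemHContLoc α s w) (m : Eu d) :
    MemHContLoc α (s + 1) (∂_{m} w) := by
  intro S hS hS'
  rw [smulLeftCLM_lineDeriv w hS hS']
  refine MemHCont.add h ((hw S hS hS').lineDeriv m) (MemHCont.const_smul ?_ _)
  have hS1 : ContDiff ℝ ∞ (fun x => fderiv ℝ S x m) :=
    (hS.fderiv_right (m := ∞) (by simp)).clm_apply contDiff_const
  exact (hw _ hS1 (hS'.fderiv_apply ℝ m)).mono_exponent (Nat.le_succ s)

lemma MemHContLoc.const_smul {s : ℕ} (hw : MemHContLoc α s w) (c : ℂ) :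
    MemHContLoc α s (c • w) := fun S hS hS' => by
  rw [map_smul]
  exact (hw S hS hS').const_smul c

lemma MemHContLoc.smulLeft {s : ℕ} (hw : MemHContLoc α s w) {S : Eu d → ℂ} (hS : ContDiff ℝ ∞ S)
    (hS' : HasCompactSupport S) :
    MemHContLoc α s (TemperedDistribution.smulLeftCLM ℂ S w) := fun S₁ hS₁ hS₁' => by
  rw [TemperedDistribution.smulLeftCLM_smulLeftCLM_apply (hS'.hasTemperateGrowth hS)
    (hS₁'.hasTemperateGrowth hS₁)]
  exact hw _ (hS.mul hS₁) hS'.mul_right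

lemma MemHContLoc.sum (h : IsRO α) {s : ℕ} {ι : Type*} (F : Finset ι) {u : ι → 𝓢'(Eu d, ℂ)}
    (hu : ∀ i ∈ F, MemHContLoc α s (u i)) : MemHContLoc α s (∑ i ∈ F, u i) := by
  classical
  intro S hS hS'
  rw [map_sum]
  have hu' := fun i hi => hu i hi S hS hS'
  clear hu
  induction F using Finset.induction_on with
  | empty => simpa using MemHCont.zero
  | insert i F hi ih =>
    rw [Finset.sum_insert hi]
    exact MemHCont.add h (hu' i (by simp)) (ih fun j hj => hu' j (by simp [hj]))

/-- The operator `D_k = i ∂_k` on tempered distributions. -/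
noncomputable def tdDpart {d : ℕ} (k : Fin d) (w : 𝓢'(Eu d, ℂ)) : 𝓢'(Eu d, ℂ) :=
  Complex.I • ∂_{(EuclideanSpace.single k (1 : ℝ) : Eu d)} w

/-- The operator `D^μ` on tempered distributions. -/
noncomputable def tdDmulti {d : ℕ} (μ : Fin d → ℕ) (w : 𝓢'(Eu d, ℂ)) : 𝓢'(Eu d, ℂ) :=
  (List.finRange d).foldr (fun k v => (tdDpart k)^[μ k] v) w

/-- The differential operator `∑_{|μ| ≤ l} c_μ D^μ` on tempered distributions, for coefficients of
temperate growth. -/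
noncomputable def tdDiffOp {d : ℕ} (l : ℕ) (c : (Fin d → ℕ) → Eu d → ℂ) (w : 𝓢'(Eu d, ℂ)) :
    𝓢'(Eu d, ℂ) :=
  ∑ k ∈ Finset.range (l + 1), ∑ μ ∈ multiIdx d k,
    TemperedDistribution.smulLeftCLM ℂ (c μ) (tdDmulti μ w)

lemma MemHContLoc.tdDpart_iterate (h : IsRO α) {s : ℕ} (hw : MemHContLoc α s w) (k : Fin d)
    (j : ℕ) : MemHContLoc α (s + j) ((tdDpart k)^[j] w) := by
  induction j with
  | zero => exact hw
  | succ j ih =>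
    rw [Function.iterate_succ_apply']
    exact (ih.lineDeriv h _).const_smul _

lemma MemHContLoc.tdDmulti (h : IsRO α) {s : ℕ} (hw : MemHContLoc α s w) (μ : Fin d → ℕ) :
    MemHContLoc α (s + ∑ k, μ k) (tdDmulti μ w) := by
  have key : ∀ l : List (Fin d), MemHContLoc α (s + (l.map μ).sum)
      (l.foldr (fun k v => (ExtendedSobolev.tdDpart k)^[μ k] v) w) := by
    intro l
    induction l with
    | nil => exact hw
    | cons k l ih =>
      rw [List.map_cons, List.sum_cons, List.foldr_cons, add_comm (μ k), ← add_assoc]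
      exact ih.tdDpart_iterate h k (μ k)
  have := key (List.finRange d)
  rwa [← List.ofFn_eq_map, List.sum_ofFn] at this

/-- A differential operator of order `l` with coefficients from `C₀^∞` maps `H^α` locally into
`H^{αρ^{-l}}`. -/
lemma MemHContLoc.tdDiffOp (h : IsRO α) {l : ℕ} (hw : MemHContLoc α 0 w)
    {c : (Fin d → ℕ) → Eu d → ℂ} (hc : ∀ μ, ContDiff ℝ ∞ (c μ))
    (hc' : ∀ μ, HasCompactSupport (c μ)) : MemHContLoc α l (tdDiffOp l c w) := by
  refine MemHContLoc.sum h _ fun k hk => MemHContLoc.sum h _ fun μ hμ => ?_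
  refine MemHContLoc.smulLeft ?_ (hc μ) (hc' μ)
  refine (hw.tdDmulti h μ).mono ?_
  have h1 := (Finset.mem_piAntidiag.1 hμ).1
  have h2 := Finset.mem_range.1 hk
  change 0 + Finset.univ.sum μ ≤ l
  omega

lemma continuous_tdDmulti (μ : Fin d → ℕ) :
    Continuous (tdDmulti μ : 𝓢'(Eu d, ℂ) → 𝓢'(Eu d, ℂ)) := by
  have h1 : ∀ k : Fin d, Continuous (tdDpart k : 𝓢'(Eu d, ℂ) → 𝓢'(Eu d, ℂ)) := fun k =>
    (LineDeriv.lineDerivOpCLM ℂ 𝓢'(Eu d, ℂ)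
      (EuclideanSpace.single k (1 : ℝ) : Eu d)).continuous.const_smul Complex.I
  unfold tdDmulti
  induction List.finRange d with
  | nil => exact continuous_id
  | cons k l ih => exact ((h1 k).iterate (μ k)).comp ih

lemma continuous_tdDiffOp (l : ℕ) (c : (Fin d → ℕ) → Eu d → ℂ) :
    Continuous (tdDiffOp l c : 𝓢'(Eu d, ℂ) → 𝓢'(Eu d, ℂ)) :=
  continuous_finsetSum _ fun _ _ => continuous_finsetSum _ fun μ _ =>
    (TemperedDistribution.smulLeftCLM ℂ (c μ)).continuous.comp (continuous_tdDmulti μ)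

/-- On Schwartz functions the distributional `D^μ` is the classical one. -/
lemma exists_schwartz_tdDmulti (μ : Fin d → ℕ) (v : 𝓢(Eu d, ℂ)) :
    ∃ v' : 𝓢(Eu d, ℂ), (v' : Eu d → ℂ) = Dmulti μ v ∧
      tdDmulti μ (SchwartzMap.toTemperedDistributionCLM (Eu d) ℂ volume v) =
        SchwartzMap.toTemperedDistributionCLM (Eu d) ℂ volume v' := by
  have step : ∀ (k : Fin d) (v : 𝓢(Eu d, ℂ)), ∃ v' : 𝓢(Eu d, ℂ), (v' : Eu d → ℂ) = Dpart k v ∧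
      tdDpart k (SchwartzMap.toTemperedDistributionCLM (Eu d) ℂ volume v) =
        SchwartzMap.toTemperedDistributionCLM (Eu d) ℂ volume v' := by
    intro k v
    refine ⟨Complex.I • ∂_{(EuclideanSpace.single k (1 : ℝ) : Eu d)} v, ?_, ?_⟩
    · ext x
      rw [smul_apply, SchwartzMap.lineDerivOp_apply_eq_fderiv, smul_eq_mul, Dpart]
    · rw [tdDpart, TemperedDistribution.lineDerivOp_toTemperedDistributionCLM_eq, map_smul]
  have iter : ∀ (k : Fin d) (j : ℕ) (v : 𝓢(Eu d, ℂ)), ∃ v' : 𝓢(Eu d, ℂ),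
      (v' : Eu d → ℂ) = (Dpart k)^[j] v ∧
      (tdDpart k)^[j] (SchwartzMap.toTemperedDistributionCLM (Eu d) ℂ volume v) =
        SchwartzMap.toTemperedDistributionCLM (Eu d) ℂ volume v' := by
    intro k j v
    induction j with
    | zero => exact ⟨v, rfl, rfl⟩
    | succ j ih =>
      obtain ⟨v', h1, h2⟩ := ih
      obtain ⟨v'', h3, h4⟩ := step k v'
      exact ⟨v'', by rw [h3, h1, Function.iterate_succ_apply'],
        by rw [Function.iterate_succ_apply', h2, h4]⟩
  unfold tdDmulti Dmulti
  induction List.finRange d with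
  | nil => exact ⟨v, rfl, rfl⟩
  | cons k l ih =>
    obtain ⟨v', h1, h2⟩ := ih
    obtain ⟨v'', h3, h4⟩ := iter k (μ k) v'
    exact ⟨v'', by rw [h3, h1, List.foldr_cons], by rw [List.foldr_cons, h2, h4]⟩

lemma tdDiffOp_apply_schwartz (l : ℕ) {c : (Fin d → ℕ) → Eu d → ℂ}
    (hc : ∀ μ, (c μ).HasTemperateGrowth) (v ψ : 𝓢(Eu d, ℂ)) :
    tdDiffOp l c (SchwartzMap.toTemperedDistributionCLM (Eu d) ℂ volume v) ψ =
      ∫ x, diffOp l c v x * ψ x := by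
  have key : ∀ μ, Integrable (fun x => c μ x * Dmulti μ v x * ψ x) ∧
      TemperedDistribution.smulLeftCLM ℂ (c μ)
        (tdDmulti μ (SchwartzMap.toTemperedDistributionCLM (Eu d) ℂ volume v)) ψ =
          ∫ x, c μ x * Dmulti μ v x * ψ x := by
    intro μ
    obtain ⟨v', h1, h2⟩ := exists_schwartz_tdDmulti μ v
    have h3 : (fun x => c μ x * Dmulti μ v x * ψ x) =
        fun x => SchwartzMap.smulLeftCLM ℂ v' (SchwartzMap.smulLeftCLM ℂ (c μ) ψ) x := by
      ext x
      rw [SchwartzMap.smulLeftCLM_apply_apply v'.hasTemperateGrowth,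
        SchwartzMap.smulLeftCLM_apply_apply (hc μ), ← h1, smul_eq_mul, smul_eq_mul]
      ring
    refine ⟨?_, ?_⟩
    · rw [h3]
      exact SchwartzMap.integrable _
    · rw [h2, TemperedDistribution.smulLeftCLM_apply_apply,
        SchwartzMap.toTemperedDistributionCLM_apply_apply volume, ← h1]
      refine integral_congr_ae (ae_of_all _ fun x => ?_)
      simp only [SchwartzMap.smulLeftCLM_apply_apply (hc μ), smul_eq_mul]
      ring
  have h4 : ∀ {ι : Type} (F : Finset ι) (u : ι → 𝓢'(Eu d, ℂ)),
      (∑ i ∈ F, u i) ψ = ∑ i ∈ F, u i ψ := fun F u =>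
    map_sum (PointwiseConvergenceCLM.evalCLM (RingHom.id ℂ) ℂ ψ) u F
  unfold tdDiffOp diffOp
  simp_rw [Finset.sum_mul]
  rw [integral_finsetSum _ fun k _ => integrable_finsetSum _ fun μ _ => (key μ).1]
  simp_rw [integral_finsetSum _ fun μ _ => (key μ).1, h4, (key _).2]

/-! ### Restriction to an open set -/

/-- The restriction to `Ω` of a tempered distribution, as a distribution on `Ω`. -/
noncomputable def restrictDistr {n : ℕ} (Ω : Opens (Eu n)) (w : 𝓢'(Eu n, ℂ)) : Distr Ω :=
  TestFunction.mkCLM ℂ (fun ψ => w (toSchwartz ψ))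
    (fun f g => by
      rw [← map_add]
      rfl)
    (fun c f => by
      rw [← map_smul]
      rfl)
    (fun K hK => by
      have h : Continuous (fun f : 𝓓_{K}(Eu n, ℂ) =>
          toSchwartz (TestFunction.ofSupportedIn hK f)) := by
        let L : 𝓓_{K}(Eu n, ℂ) →ₗ[ℂ] 𝓢(Eu n, ℂ) :=
          { toFun := fun f => toSchwartz (TestFunction.ofSupportedIn hK f)
            map_add' := fun _ _ => rfl
            map_smul' := fun _ _ => rfl }
        obtain ⟨R, hR0, hR⟩ := K.isCompact.isBounded.exists_pos_norm_le
        refine (ContDiffMapSupportedIn.withSeminorms ℂ (Eu n) ℂ ⊤ K).continuous_of_isBounded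
          (schwartz_withSeminorms ℂ (Eu n) ℂ) L fun i => ⟨{i.2}, ⟨R ^ i.1, by positivity⟩, ?_⟩
        intro f
        have h0 : 0 ≤ R ^ i.1 * ContDiffMapSupportedIn.seminorm ℂ (Eu n) ℂ ⊤ K i.2 f :=
          mul_nonneg (by positivity) (apply_nonneg _ _)
        have h1 := (L f).seminorm_le_bound ℂ i.1 i.2 h0 fun x => by
          change ‖x‖ ^ i.1 * ‖iteratedFDeriv ℝ i.2 f x‖ ≤ _
          by_cases hx : x ∈ K
          · have := ContDiffMapSupportedIn.norm_iteratedFDeriv_apply_le_seminorm_top ℂ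
              (f := f) (i := i.2) (x := x)
            have := hR x hx
            gcongr
          · rw [f.iteratedFDeriv_zero_on_compl hx]
            simpa using h0
        rw [Finset.sup_singleton]
        exact h1
      exact (w.continuous).comp h)

/-! ### Fourier transforms of rescaled bumps -/

section Lump

variable {n : ℕ} {S θ : Eu n → ℂ}

lemma contDiff_lump (hθ : ContDiff ℝ ∞ θ) (x₀ : Eu n) (t : ℝ) :
    ContDiff ℝ ∞ (fun x => θ (t • (x - x₀))) := by
  fun_prop

lemma tsupport_lump_subset (hθ' : tsupport θ ⊆ Metric.closedBall 0 2) (x₀ : Eu n) {t : ℝ}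
    (ht : 1 ≤ t) : tsupport (fun x => θ (t • (x - x₀))) ⊆ Metric.closedBall x₀ (2 / t) := by
  refine closure_minimal (fun x hx => ?_) Metric.isClosed_closedBall
  have h1 : t • (x - x₀) ∈ Metric.closedBall 0 2 := hθ' (subset_tsupport θ hx)
  have h0 : 0 < t := by linarith
  rw [mem_closedBall_zero_iff, norm_smul, Real.norm_of_nonneg h0.le] at h1
  rw [Metric.mem_closedBall, dist_eq_norm, le_div_iff₀ h0]
  linarith

/-- The `L¹`-norms of the derivatives of order `j` of `S(x) θ(t(x - x₀))` are `O(t^{j-n})`. -/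
lemma exists_integral_iteratedFDeriv_lump_le (hS : ContDiff ℝ ∞ S) (hθ : ContDiff ℝ ∞ θ)
    (hθ' : tsupport θ ⊆ Metric.closedBall 0 2) (x₀ : Eu n) (j : ℕ) :
    ∃ C : ℝ, 0 ≤ C ∧ ∀ t ≥ (1 : ℝ),
      Integrable (fun x => ‖iteratedFDeriv ℝ j (fun x => S x * θ (t • (x - x₀))) x‖) ∧
      ∫ x, ‖iteratedFDeriv ℝ j (fun x => S x * θ (t • (x - x₀))) x‖ ≤ C * t ^ j / t ^ n := by
  have hScont : ∀ i, Continuous (iteratedFDeriv ℝ i S) := fun i =>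
    hS.continuous_iteratedFDeriv (by exact_mod_cast le_top)
  have hθcont : ∀ i, Continuous (iteratedFDeriv ℝ i θ) := fun i =>
    hθ.continuous_iteratedFDeriv (by exact_mod_cast le_top)
  choose CS hCS using fun i => (isCompact_closedBall x₀ 2).exists_bound_of_continuousOn
    (hScont i).continuousOn
  have hθc : HasCompactSupport θ := (isCompact_closedBall (0 : Eu n) 2).of_isClosed_subset
    (isClosed_tsupport θ) hθ'
  choose Cθ hCθ using fun i => (hθc.iteratedFDeriv (𝕜 := ℝ) i).exists_bound_of_continuous (hθcont i)
  have hCθ0 : ∀ i, 0 ≤ Cθ i := fun i => (norm_nonneg _).trans (hCθ i 0)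
  have hCS0 : ∀ i, 0 ≤ CS i := fun i =>
    (norm_nonneg _).trans (hCS i x₀ (Metric.mem_closedBall_self (by norm_num)))
  set A : ℝ := ∑ i ∈ Finset.range (j + 1), (j.choose i : ℝ) * CS i * Cθ (j - i) with hA
  have hA0 : 0 ≤ A := Finset.sum_nonneg fun i _ =>
    mul_nonneg (mul_nonneg (Nat.cast_nonneg _) (hCS0 i)) (hCθ0 _)
  refine ⟨A * 2 ^ n * volume.real (Metric.ball (0 : Eu n) 1), by positivity, fun t ht => ?_⟩
  have ht0 : 0 < t := by linarith
  set f : Eu n → ℂ := fun x => S x * θ (t • (x - x₀)) with hf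
  have hfs : ContDiff ℝ ∞ f := hS.mul (contDiff_lump hθ x₀ t)
  have hfsupp : tsupport f ⊆ Metric.closedBall x₀ (2 / t) :=
    tsupport_mul_subset_right.trans (tsupport_lump_subset hθ' x₀ ht)
  have hfc : HasCompactSupport f :=
    (isCompact_closedBall x₀ (2 / t)).of_isClosed_subset (isClosed_tsupport f) hfsupp
  have hcont : Continuous (iteratedFDeriv ℝ j f) :=
    hfs.continuous_iteratedFDeriv (by exact_mod_cast le_top)
  have hder : ∀ i x, ‖iteratedFDeriv ℝ i (fun x => θ (t • (x - x₀))) x‖ ≤ t ^ i * Cθ i := by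
    intro i x
    have h1 : iteratedFDeriv ℝ i (fun x => θ (t • (x - x₀))) x =
        iteratedFDeriv ℝ i (fun x => θ (t • x)) (x - x₀) :=
      congrFun (iteratedFDeriv_comp_sub' (f := fun y => θ (t • y)) i x₀) x
    rw [h1, iteratedFDeriv_comp_const_smul t (hθ.of_le (by exact_mod_cast le_top))]
    rw [norm_smul, norm_pow, Real.norm_of_nonneg ht0.le]
    gcongr
    exact hCθ i _
  have hbound : ∀ x ∈ Metric.closedBall x₀ (2 / t), ‖iteratedFDeriv ℝ j f x‖ ≤ A * t ^ j := by
    intro x hx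
    have hx2 : x ∈ Metric.closedBall x₀ 2 :=
      Metric.closedBall_subset_closedBall (div_le_self (by norm_num) ht) hx
    refine (norm_iteratedFDeriv_mul_le hS (contDiff_lump hθ x₀ t) x (n := j)
      (by exact_mod_cast le_top)).trans ?_
    rw [hA, Finset.sum_mul]
    refine Finset.sum_le_sum fun i hi => ?_
    have h1 := hCS i x hx2
    have h2 := hder (j - i) x
    have h3 : t ^ (j - i) ≤ t ^ j := pow_le_pow_right₀ ht (Nat.sub_le j i)
    have h4 := hCθ0 (j - i)
    have h5 := hCS0 i
    calc (j.choose i : ℝ) * ‖iteratedFDeriv ℝ i S x‖ *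
          ‖iteratedFDeriv ℝ (j - i) (fun x => θ (t • (x - x₀))) x‖
        ≤ (j.choose i : ℝ) * CS i * (t ^ (j - i) * Cθ (j - i)) := by gcongr
      _ ≤ (j.choose i : ℝ) * CS i * (t ^ j * Cθ (j - i)) := by gcongr
      _ = _ := by ring
  have hsupp : Function.support (fun x => ‖iteratedFDeriv ℝ j f x‖) ⊆
      Metric.closedBall x₀ (2 / t) := by
    intro x hx
    apply hfsupp
    apply support_iteratedFDeriv_subset (𝕜 := ℝ) j
    simpa using hx
  refine ⟨?_, ?_⟩
  · exact hcont.norm.integrable_of_hasCompactSupport (hfc.iteratedFDeriv (𝕜 := ℝ) j).norm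
  · rw [← setIntegral_eq_integral_of_forall_compl_eq_zero
      (s := Metric.closedBall x₀ (2 / t)) (fun x hx => by
        by_contra h
        exact hx (hsupp h))]
    have h1 := norm_setIntegral_le_of_norm_le_const (μ := volume)
      (s := Metric.closedBall x₀ (2 / t)) (f := fun x => ‖iteratedFDeriv ℝ j f x‖)
      (C := A * t ^ j) (isCompact_closedBall x₀ (2 / t)).measure_lt_top
      (fun x hx => by rw [norm_norm]; exact hbound x hx)
    refine ((le_abs_self _).trans h1).trans (le_of_eq ?_)
    have h2 : volume.real (Metric.closedBall x₀ (2 / t)) =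
        (2 / t) ^ n * volume.real (Metric.ball (0 : Eu n) 1) := by
      rw [Measure.real, Measure.addHaar_closedBall _ _ (by positivity), ENNReal.toReal_mul,
        ENNReal.toReal_ofReal (by positivity), finrank_euclideanSpace, Fintype.card_fin]
      rfl
    rw [h2, div_pow]
    field_simp

/-- The function `S(x) θ(t(x - x₀))` has a Fourier transform of size `t^{-n}`, concentrated on
frequencies of order at most `t`. -/
lemma exists_fourier_lump_le (hS : ContDiff ℝ ∞ S) (hθ : ContDiff ℝ ∞ θ)
    (hθ' : tsupport θ ⊆ Metric.closedBall 0 2) (x₀ : Eu n) (M : ℕ) :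
    ∃ C : ℝ, 0 ≤ C ∧ ∀ t ≥ (1 : ℝ), ∀ ξ : Eu n,
      ‖𝓕 (fun x => S x * θ (t • (x - x₀))) ξ‖ ≤ C / t ^ n ∧
      (Real.sqrt (1 + ‖ξ‖ ^ 2) / t) ^ M * ‖𝓕 (fun x => S x * θ (t • (x - x₀))) ξ‖ ≤
        C / t ^ n := by
  choose C hC0 hC using exists_integral_iteratedFDeriv_lump_le hS hθ hθ' x₀
  have key : ∀ N : ℕ, ∃ D : ℝ, 0 ≤ D ∧ ∀ t ≥ (1 : ℝ), ∀ ξ : Eu n,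
      ‖ξ‖ ^ N * ‖𝓕 (fun x => S x * θ (t • (x - x₀))) ξ‖ ≤ D * t ^ N / t ^ n := by
    intro N
    refine ⟨2 ^ N * ∑ j ∈ Finset.range (N + 1), C j,
      mul_nonneg (by positivity) (Finset.sum_nonneg fun j _ => hC0 j), fun t ht ξ => ?_⟩
    have ht0 : 0 < t := by linarith
    have h1 := Real.pow_mul_norm_iteratedFDeriv_fourier_le (K := 0) (N := ⊤)
      (f := fun x => S x * θ (t • (x - x₀))) (hS.mul (contDiff_lump hθ x₀ t))
      (fun k j hk _ => by
        have : k = 0 := by simpa using hk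
        subst this
        simpa using (hC j t ht).1) (k := 0) (n := N) le_rfl le_top ξ
    rw [norm_iteratedFDeriv_zero] at h1
    refine h1.trans ?_
    simp only [pow_zero, one_mul, Nat.cast_zero, mul_zero, zero_add, Finset.range_one,
      Finset.sum_product, Finset.sum_singleton]
    rw [mul_div_assoc, mul_assoc, Finset.sum_mul]
    gcongr with j hj
    refine (hC j t ht).2.trans ?_
    rw [mul_div_assoc]
    have := Finset.mem_range.1 hj
    have := hC0 j
    gcongr
    omega
  obtain ⟨D₀, hD₀, h₀⟩ := key 0
  obtain ⟨D, hD, h⟩ := key M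
  refine ⟨D₀ + 2 ^ M * (D₀ + D), by positivity, fun t ht ξ => ?_⟩
  have ht0 : 0 < t := by linarith
  have hF := norm_nonneg (𝓕 (fun x => S x * θ (t • (x - x₀))) ξ)
  set F := ‖𝓕 (fun x => S x * θ (t • (x - x₀))) ξ‖
  have h1 : F ≤ D₀ / t ^ n := by simpa using h₀ t ht ξ
  have h2 : ‖ξ‖ ^ M * F ≤ D * t ^ M / t ^ n := h t ht ξ
  refine ⟨h1.trans ?_, ?_⟩
  · gcongr
    have : 0 ≤ 2 ^ M * (D₀ + D) := by positivity
    linarith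
  · have h3 : Real.sqrt (1 + ‖ξ‖ ^ 2) ≤ 1 + ‖ξ‖ := by
      rw [Real.sqrt_le_left (by positivity)]
      nlinarith [norm_nonneg ξ]
    -- either `|ξ| ≤ t` or `|ξ| ≥ t`, and then `⟨ξ⟩ ≤ 2t` or `⟨ξ⟩ ≤ 2|ξ|`
    have h4 : (Real.sqrt (1 + ‖ξ‖ ^ 2) / t) ^ M ≤ 2 ^ M * (1 + ‖ξ‖ ^ M / t ^ M) := by
      rcases le_total ‖ξ‖ t with hle | hle
      · have : Real.sqrt (1 + ‖ξ‖ ^ 2) / t ≤ 2 := by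
          rw [div_le_iff₀ ht0]
          linarith
        have h5 : 0 ≤ ‖ξ‖ ^ M / t ^ M := by positivity
        calc (Real.sqrt (1 + ‖ξ‖ ^ 2) / t) ^ M ≤ 2 ^ M := by gcongr
          _ ≤ 2 ^ M * (1 + ‖ξ‖ ^ M / t ^ M) := le_mul_of_one_le_right (by positivity) (by linarith)
      · have : Real.sqrt (1 + ‖ξ‖ ^ 2) / t ≤ 2 * (‖ξ‖ / t) := by
          rw [← mul_div_assoc]
          gcongr
          linarith
        calc (Real.sqrt (1 + ‖ξ‖ ^ 2) / t) ^ M ≤ (2 * (‖ξ‖ / t)) ^ M := by gcongr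
          _ = 2 ^ M * (‖ξ‖ ^ M / t ^ M) := by rw [mul_pow, div_pow]
          _ ≤ 2 ^ M * (1 + ‖ξ‖ ^ M / t ^ M) := by gcongr; linarith
    calc (Real.sqrt (1 + ‖ξ‖ ^ 2) / t) ^ M * F ≤ 2 ^ M * (1 + ‖ξ‖ ^ M / t ^ M) * F := by gcongr
      _ = 2 ^ M * (F + ‖ξ‖ ^ M * F / t ^ M) := by ring
      _ ≤ 2 ^ M * (D₀ / t ^ n + D * t ^ M / t ^ n / t ^ M) := by gcongr
      _ = 2 ^ M * (D₀ + D) / t ^ n := by field_simp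
      _ ≤ (D₀ + 2 ^ M * (D₀ + D)) / t ^ n := by gcongr; linarith

end Lump

/-! ### Almost orthogonality of lacunary sums -/

/-- The Cauchy–Schwarz inequality with weights. -/
lemma tsum_mul_sq_le (b w : ℕ → ℝ≥0∞) :
    (∑' k, b k * w k) ^ 2 ≤ (∑' k, b k ^ 2 * w k) * ∑' k, w k := by
  have hsq : ∀ x : ℝ≥0∞, (x ^ (1 / 2 : ℝ)) ^ (2 : ℝ) = x := fun x => by
    rw [← ENNReal.rpow_mul]; norm_num
  have hmul : ∀ x : ℝ≥0∞, x ^ (1 / 2 : ℝ) * x ^ (1 / 2 : ℝ) = x := fun x => by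
    have := hsq x
    rwa [ENNReal.rpow_two, pow_two] at this
  have key : ∑' k, b k * w k ≤
      ((∑' k, b k ^ 2 * w k) * ∑' k, w k) ^ (1 / 2 : ℝ) := by
    refine ENNReal.summable.tsum_le_of_sum_le fun F => ?_
    have := ENNReal.inner_le_Lp_mul_Lq F (fun k => b k * w k ^ (1 / 2 : ℝ))
      (fun k => w k ^ (1 / 2 : ℝ)) (p := 2) (q := 2) (by
        rw [Real.holderConjugate_iff]; norm_num)
    simp only [mul_assoc, hmul, hsq, ENNReal.mul_rpow_of_nonneg _ _ zero_le_two,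
      ENNReal.rpow_two (b _)] at this
    refine this.trans ?_
    rw [ENNReal.mul_rpow_of_nonneg _ _ (by norm_num)]
    gcongr <;> exact ENNReal.sum_le_tsum F
  calc (∑' k, b k * w k) ^ 2 ≤
        (((∑' k, b k ^ 2 * w k) * ∑' k, w k) ^ (1 / 2 : ℝ)) ^ 2 := by gcongr
    _ = _ := by rw [← ENNReal.rpow_two, hsq]

/-- The weight `min(s^{1/2}, s^{-(n+1)})`, which controls the interaction of two frequencies with the
ratio `s`. -/
noncomputable def decayWeight (n : ℕ) (s : ℝ) : ℝ := min (Real.sqrt s) (s⁻¹ ^ (n + 1))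

lemma decayWeight_of_le_one {n : ℕ} {s : ℝ} (h0 : 0 < s) (h1 : s ≤ 1) :
    decayWeight n s = Real.sqrt s :=
  min_eq_left ((Real.sqrt_le_one.2 h1).trans (one_le_pow₀ ((one_le_inv₀ h0).2 h1)))

lemma decayWeight_of_one_le {n : ℕ} {s : ℝ} (h1 : 1 ≤ s) :
    decayWeight n s = s⁻¹ ^ (n + 1) :=
  min_eq_right ((pow_le_one₀ (by positivity) (inv_le_one_of_one_le₀ h1)).trans
    (Real.one_le_sqrt.2 h1))

/-- The sums of `decayWeight` over a dyadic sequence of scales are uniformly bounded. -/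
lemma exists_tsum_decayWeight_le (n k₀ : ℕ) :
    ∃ D : ℝ≥0∞, D ≠ ⊤ ∧ ∀ R ≥ (1 : ℝ),
      ∑' k : ℕ, ENNReal.ofReal (decayWeight n (R / 2 ^ (k + k₀))) ≤ D := by
  set r : ℝ := Real.sqrt (1 / 2) with hr
  have hr0 : 0 ≤ r := Real.sqrt_nonneg _
  have hr2 : r ^ 2 = 1 / 2 := Real.sq_sqrt (by norm_num)
  have hr1 : r < 1 := by nlinarith
  have hr3 : 1 / 2 ≤ r := by nlinarith
  have hsum : Summable (fun z : ℤ => 2 * r ^ z.natAbs) := by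
    apply Summable.mul_left
    apply Summable.of_nat_of_neg <;> simpa using summable_geometric_of_lt_one hr0 hr1
  refine ⟨∑' z : ℤ, ENNReal.ofReal (2 * r ^ z.natAbs), hsum.tsum_ofReal_ne_top, fun R hR => ?_⟩
  obtain ⟨m, hm1, hm2⟩ := exists_nat_pow_near hR one_lt_two
  have hinj : Function.Injective (fun k : ℕ => ((k + k₀ : ℕ) : ℤ) - m) := fun a b h => by
    simpa using h
  refine le_trans (ENNReal.tsum_le_tsum fun k => ENNReal.ofReal_le_ofReal ?_)
    (ENNReal.tsum_comp_le_tsum_of_injective hinj fun z : ℤ => ENNReal.ofReal (2 * r ^ z.natAbs))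
  have hT : (0 : ℝ) < 2 ^ (k + k₀) := by positivity
  rcases le_total m (k + k₀) with hle | hle
  · obtain ⟨j, hj⟩ := Nat.exists_eq_add_of_le hle
    have h1 : (((k + k₀ : ℕ) : ℤ) - m).natAbs = j := by omega
    rw [h1]
    refine (min_le_left _ _).trans ?_
    rw [Real.sqrt_le_left (by positivity), mul_pow, ← pow_mul, mul_comm j 2, pow_mul, hr2,
      div_le_iff₀ hT, hj, pow_add]
    calc R ≤ 2 ^ (m + 1) := hm2.le
      _ ≤ 4 * 2 ^ m := by rw [pow_succ]; nlinarith [pow_pos (two_pos (α := ℝ)) m]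
      _ = 2 ^ 2 * (1 / 2) ^ j * (2 ^ m * 2 ^ j) := by
        rw [one_div, inv_pow]
        field_simp
        norm_num
  · obtain ⟨j, hj⟩ := Nat.exists_eq_add_of_le hle
    have h1 : (((k + k₀ : ℕ) : ℤ) - m).natAbs = j := by omega
    rw [h1]
    refine (min_le_right _ _).trans ?_
    have h2 : (2 : ℝ) ^ j ≤ R / 2 ^ (k + k₀) := by
      rw [le_div_iff₀ hT, ← pow_add, add_comm j, ← hj]
      exact hm1
    have h3 : (R / 2 ^ (k + k₀))⁻¹ ≤ (1 / 2) ^ j := by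
      rw [one_div, inv_pow]
      exact inv_anti₀ (by positivity) h2
    have h4 : 0 ≤ (R / 2 ^ (k + k₀))⁻¹ := by positivity
    have h5 : (R / 2 ^ (k + k₀))⁻¹ ≤ 1 := h3.trans (pow_le_one₀ (by norm_num) (by norm_num))
    calc (R / 2 ^ (k + k₀))⁻¹ ^ (n + 1) ≤ (R / 2 ^ (k + k₀))⁻¹ :=
          pow_le_of_le_one h4 h5 (Nat.succ_ne_zero n)
      _ ≤ (1 / 2) ^ j := h3
      _ ≤ r ^ j := by gcongr
      _ ≤ 2 * r ^ j := by linarith [pow_nonneg hr0 j]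

/-- Uniformly in `t ≥ 1`, the weight `decayWeight` at the frequency ratio `⟨ξ⟩ / t` has the integral
`O(tⁿ)`. -/
lemma exists_lintegral_decayWeight_le (n : ℕ) :
    ∃ E : ℝ≥0∞, E ≠ ⊤ ∧ ∀ t ≥ (1 : ℝ),
      ∫⁻ ξ : Eu n, ENNReal.ofReal ((t ^ n)⁻¹ * decayWeight n (Real.sqrt (1 + ‖ξ‖ ^ 2) / t)) ≤
        E := by
  set f : Eu n → ℝ := fun η => (2 / (1 + ‖η‖)) ^ (n + 1) with hf
  have hfi : Integrable f := by
    have h1 := (integrable_one_add_norm (E := Eu n) (μ := volume) (r := (n + 1 : ℝ))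
      (by simp)).const_mul (2 ^ (n + 1))
    refine h1.congr (ae_of_all _ fun η => ?_)
    have : (0 : ℝ) < 1 + ‖η‖ := by positivity
    simp only [hf]
    rw [Real.rpow_neg this.le, div_pow]
    norm_cast
  refine ⟨ENNReal.ofReal (∫ η, f η), ENNReal.ofReal_ne_top, fun t ht => ?_⟩
  have ht0 : 0 < t := by linarith
  have hfi' : Integrable (fun ξ => (t ^ n)⁻¹ * f (t⁻¹ • ξ)) :=
    (hfi.comp_smul (inv_ne_zero ht0.ne')).const_mul _
  have hint : ∫ ξ, (t ^ n)⁻¹ * f (t⁻¹ • ξ) = ∫ η, f η := by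
    rw [integral_const_mul, Measure.integral_comp_smul, finrank_euclideanSpace, Fintype.card_fin,
      inv_pow, inv_inv, abs_of_pos (by positivity), smul_eq_mul]
    field_simp
  rw [← hint, ofReal_integral_eq_lintegral_ofReal hfi' (ae_of_all _ fun ξ => by
    simp only [hf]; positivity)]
  refine lintegral_mono fun ξ => ENNReal.ofReal_le_ofReal ?_
  simp only [hf]
  gcongr
  have h1 := norm_le_sqrt_one_add_sq ξ
  have h2 := one_le_sqrt_one_add_sq ξ
  have h3 : ‖t⁻¹ • ξ‖ ≤ Real.sqrt (1 + ‖ξ‖ ^ 2) / t := by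
    rw [norm_smul, norm_inv, Real.norm_of_nonneg ht0.le, inv_mul_eq_div]
    gcongr
  have h4 : 0 < Real.sqrt (1 + ‖ξ‖ ^ 2) / t := by positivity
  set s := Real.sqrt (1 + ‖ξ‖ ^ 2) / t
  have h5 : (0 : ℝ) < 1 + ‖t⁻¹ • ξ‖ := by positivity
  rcases le_total s 1 with hs | hs
  · rw [decayWeight_of_le_one h4 hs]
    refine (Real.sqrt_le_one.2 hs).trans (one_le_pow₀ ?_)
    rw [one_le_div h5]
    linarith
  · rw [decayWeight_of_one_le hs]
    gcongr
    rw [le_div_iff₀ h5, inv_mul_le_iff₀ h4]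
    linarith

/-- Let `G_k` be functions of size `t_k^{-n}` that are concentrated on frequencies of order at most
`t_k = 2^{k+k₀}`. Normalized in `H^α`, they are almost orthogonal: since `α` grows faster than
`t^{1/2}`, the weight is small at the frequencies below `t_k`, where `G_k` does not decay. -/
lemma exists_weightedSq_tsum_le {α : ℝ → ℝ} (h : IsRO α) (hα : 1 / 2 < lowerIndex α)
    (n k₀ : ℕ) :
    ∃ M : ℕ, ∀ C : ℝ, 0 ≤ C → ∃ E : ℝ≥0∞, E ≠ ⊤ ∧ ∀ G : ℕ → Eu n → ℂ,
      (∀ k ξ, ‖G k ξ‖ ≤ C / ((2 : ℝ) ^ (k + k₀)) ^ n ∧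
        (Real.sqrt (1 + ‖ξ‖ ^ 2) / 2 ^ (k + k₀)) ^ M * ‖G k ξ‖ ≤
          C / ((2 : ℝ) ^ (k + k₀)) ^ n) →
      ∀ b : ℕ → ℝ,
        weightedSq α (fun ξ => ∑' k, ((b k * Real.sqrt (((2 : ℝ) ^ (k + k₀)) ^ n) /
          α (2 ^ (k + k₀)) : ℝ) : ℂ) * G k ξ) ≤ E * ∑' k, ENNReal.ofReal (b k ^ 2) := by
  obtain ⟨K, C₀, hC₀, hup⟩ := h.exists_le_mul_pow
  obtain ⟨c, hc, hlow⟩ := exists_mul_rpow_le_of_lt_lowerIndex h (by norm_num) hα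
  obtain ⟨D, hD, hDle⟩ := exists_tsum_decayWeight_le n k₀
  obtain ⟨E, hE, hEle⟩ := exists_lintegral_decayWeight_le n
  -- `K` powers of the decay absorb the growth of `α`, the other `n + 1` remain in `decayWeight`
  refine ⟨K + (n + 1), fun C hC => ?_⟩
  set A : ℝ := C * (c⁻¹ + C₀) with hA
  have hA0 : 0 ≤ A := by positivity
  refine ⟨ENNReal.ofReal (A ^ 2) * D * E, ENNReal.mul_ne_top (ENNReal.mul_ne_top (by simp) hD) hE,
    fun G hG b => ?_⟩
  set t : ℕ → ℝ := fun k => 2 ^ (k + k₀) with ht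
  have ht1 : ∀ k, 1 ≤ t k := fun k => one_le_pow₀ (by norm_num)
  have ht0 : ∀ k, 0 < t k := fun k => by linarith [ht1 k]
  set R : Eu n → ℝ := fun ξ => Real.sqrt (1 + ‖ξ‖ ^ 2) with hR
  have hR1 : ∀ ξ, 1 ≤ R ξ := one_le_sqrt_one_add_sq
  set w : ℕ → Eu n → ℝ := fun k ξ => decayWeight n (R ξ / t k) with hw
  have key : ∀ k ξ, α (R ξ) * ‖G k ξ‖ ≤ A * α (t k) / t k ^ n * w k ξ := by
    intro k ξ
    have h1 := hR1 ξ
    have hR0 : 0 < R ξ := by linarith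
    have hαR := h.pos _ h1
    have hαt := h.pos _ (ht1 k)
    have htk := ht0 k
    obtain ⟨hG1, hG2⟩ := hG k ξ
    change ‖G k ξ‖ ≤ C / t k ^ n at hG1
    change (R ξ / t k) ^ (K + (n + 1)) * ‖G k ξ‖ ≤ C / t k ^ n at hG2
    have hG0 := norm_nonneg (G k ξ)
    have hs0 : 0 < R ξ / t k := by positivity
    -- the lower index bounds `α` at the low frequencies, the upper growth at the high ones
    rcases le_total (R ξ) (t k) with hle | hle
    · have hs1 : R ξ / t k ≤ 1 := (div_le_one htk).2 hle
      have h2 := hlow (R ξ) h1 (t k / R ξ) ((one_le_div hR0).2 hle)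
      rw [div_mul_cancel₀ _ hR0.ne', ← Real.sqrt_eq_rpow] at h2
      have h3 : Real.sqrt (t k / R ξ) * Real.sqrt (R ξ / t k) = 1 := by
        rw [← Real.sqrt_mul (by positivity), div_mul_div_cancel₀ hR0.ne', div_self htk.ne',
          Real.sqrt_one]
      have h4 : α (R ξ) ≤ c⁻¹ * α (t k) * Real.sqrt (R ξ / t k) := by
        calc α (R ξ) = c⁻¹ * (c * (Real.sqrt (t k / R ξ) * Real.sqrt (R ξ / t k)) * α (R ξ)) := by
              rw [h3]; field_simp
          _ = c⁻¹ * (c * Real.sqrt (t k / R ξ) * α (R ξ)) * Real.sqrt (R ξ / t k) := by ring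
          _ ≤ c⁻¹ * α (t k) * Real.sqrt (R ξ / t k) := by gcongr
      rw [hw]
      simp only
      rw [decayWeight_of_le_one hs0 hs1]
      calc α (R ξ) * ‖G k ξ‖
          ≤ c⁻¹ * α (t k) * Real.sqrt (R ξ / t k) * (C / t k ^ n) := by gcongr
        _ = C * c⁻¹ * α (t k) / t k ^ n * Real.sqrt (R ξ / t k) := by ring
        _ ≤ A * α (t k) / t k ^ n * Real.sqrt (R ξ / t k) := by
          rw [hA]
          gcongr
          linarith
    · have hs1 : 1 ≤ R ξ / t k := (one_le_div htk).2 hle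
      have h2 := hup (t k) (ht1 k) (R ξ / t k) hs1
      rw [div_mul_cancel₀ _ htk.ne'] at h2
      rw [hw]
      simp only
      rw [decayWeight_of_one_le hs1]
      set s := R ξ / t k
      have h3 : s ^ K * ‖G k ξ‖ ≤ C / t k ^ n * s⁻¹ ^ (n + 1) := by
        calc s ^ K * ‖G k ξ‖ = s ^ (K + (n + 1)) * ‖G k ξ‖ * s⁻¹ ^ (n + 1) := by
              rw [pow_add, inv_pow]; field_simp
          _ ≤ C / t k ^ n * s⁻¹ ^ (n + 1) := by gcongr
      calc α (R ξ) * ‖G k ξ‖ ≤ C₀ * s ^ K * α (t k) * ‖G k ξ‖ := by gcongr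
        _ = C₀ * α (t k) * (s ^ K * ‖G k ξ‖) := by ring
        _ ≤ C₀ * α (t k) * (C / t k ^ n * s⁻¹ ^ (n + 1)) := by gcongr
        _ = C * C₀ * α (t k) / t k ^ n * s⁻¹ ^ (n + 1) := by ring
        _ ≤ A * α (t k) / t k ^ n * s⁻¹ ^ (n + 1) := by
          rw [hA]
          gcongr
          linarith [inv_pos.2 hc]
  have hterm : ∀ k ξ, ENNReal.ofReal (α (R ξ)) *
      ‖((b k * Real.sqrt (t k ^ n) / α (t k) : ℝ) : ℂ) * G k ξ‖ₑ ≤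
        ENNReal.ofReal A * (ENNReal.ofReal (|b k| / Real.sqrt (t k ^ n)) *
          ENNReal.ofReal (w k ξ)) := by
    intro k ξ
    have hαR := h.pos _ (hR1 ξ)
    have hαt := h.pos _ (ht1 k)
    have htk := ht0 k
    rw [← ofReal_norm, ← ENNReal.ofReal_mul hαR.le,
      ← ENNReal.ofReal_mul (by positivity), ← ENNReal.ofReal_mul hA0]
    refine ENNReal.ofReal_le_ofReal ?_
    have hsq : Real.sqrt (t k ^ n) * Real.sqrt (t k ^ n) = t k ^ n :=
      Real.mul_self_sqrt (by positivity)
    have hsq0 : 0 < Real.sqrt (t k ^ n) := Real.sqrt_pos.2 (by positivity)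
    rw [norm_mul, Complex.norm_real, Real.norm_eq_abs, abs_div, abs_mul, abs_of_pos hsq0,
      abs_of_pos hαt]
    calc α (R ξ) * (|b k| * Real.sqrt (t k ^ n) / α (t k) * ‖G k ξ‖)
        = |b k| * Real.sqrt (t k ^ n) / α (t k) * (α (R ξ) * ‖G k ξ‖) := by ring
      _ ≤ |b k| * Real.sqrt (t k ^ n) / α (t k) * (A * α (t k) / t k ^ n * w k ξ) :=
        mul_le_mul_of_nonneg_left (key k ξ) (by positivity)
      _ = A * (|b k| / Real.sqrt (t k ^ n) * w k ξ) := by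
        generalize Real.sqrt (t k ^ n) = q at hsq hsq0 ⊢
        rw [← hsq]
        field_simp
  have hpoint : ∀ ξ, ENNReal.ofReal (α (R ξ) ^ 2 *
      ‖∑' k, ((b k * Real.sqrt (t k ^ n) / α (t k) : ℝ) : ℂ) * G k ξ‖ ^ 2) ≤
        ENNReal.ofReal (A ^ 2) * D * ∑' k, ENNReal.ofReal (b k ^ 2) *
          ENNReal.ofReal ((t k ^ n)⁻¹ * w k ξ) := by
    intro ξ
    have hαR := h.pos _ (hR1 ξ)
    rw [← mul_pow, ENNReal.ofReal_pow (by positivity), ENNReal.ofReal_mul hαR.le,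
      ofReal_norm]
    have h1 : ENNReal.ofReal (α (R ξ)) *
        ‖∑' k, ((b k * Real.sqrt (t k ^ n) / α (t k) : ℝ) : ℂ) * G k ξ‖ₑ ≤
        ENNReal.ofReal A * ∑' k, ENNReal.ofReal (|b k| / Real.sqrt (t k ^ n)) *
          ENNReal.ofReal (w k ξ) := by
      rw [← ENNReal.tsum_mul_left]
      calc _ ≤ ENNReal.ofReal (α (R ξ)) *
            ∑' k, ‖((b k * Real.sqrt (t k ^ n) / α (t k) : ℝ) : ℂ) * G k ξ‖ₑ := by
              gcongr
              exact enorm_tsum_le_tsum_enorm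
        _ = _ := ENNReal.tsum_mul_left.symm
        _ ≤ _ := ENNReal.tsum_le_tsum fun k => hterm k ξ
    calc _ ≤ (ENNReal.ofReal A * ∑' k, ENNReal.ofReal (|b k| / Real.sqrt (t k ^ n)) *
          ENNReal.ofReal (w k ξ)) ^ 2 := by gcongr
      _ = ENNReal.ofReal (A ^ 2) * (∑' k, ENNReal.ofReal (|b k| / Real.sqrt (t k ^ n)) *
          ENNReal.ofReal (w k ξ)) ^ 2 := by rw [mul_pow, ENNReal.ofReal_pow hA0]
      _ ≤ ENNReal.ofReal (A ^ 2) * ((∑' k, ENNReal.ofReal (|b k| / Real.sqrt (t k ^ n)) ^ 2 *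
          ENNReal.ofReal (w k ξ)) * ∑' k, ENNReal.ofReal (w k ξ)) := by
            gcongr
            exact tsum_mul_sq_le _ _
      _ ≤ ENNReal.ofReal (A ^ 2) * ((∑' k, ENNReal.ofReal (|b k| / Real.sqrt (t k ^ n)) ^ 2 *
          ENNReal.ofReal (w k ξ)) * D) := by
            gcongr
            exact hDle (R ξ) (hR1 ξ)
      _ = ENNReal.ofReal (A ^ 2) * D * ∑' k, ENNReal.ofReal (|b k| / Real.sqrt (t k ^ n)) ^ 2 *
          ENNReal.ofReal (w k ξ) := by ring
      _ = _ := by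
        congr 2
        ext k
        have htk := ht0 k
        rw [← ENNReal.ofReal_pow (by positivity), ← ENNReal.ofReal_mul (by positivity),
          ← ENNReal.ofReal_mul (by positivity), div_pow, sq_abs, Real.sq_sqrt (by positivity)]
        congr 1
        ring
  have hmeas : ∀ k, Measurable fun ξ : Eu n => ENNReal.ofReal ((t k ^ n)⁻¹ * w k ξ) := by
    intro k
    simp only [hw, decayWeight, hR]
    fun_prop
  calc weightedSq α _ ≤ ∫⁻ ξ, ENNReal.ofReal (A ^ 2) * D * ∑' k, ENNReal.ofReal (b k ^ 2) *
          ENNReal.ofReal ((t k ^ n)⁻¹ * w k ξ) := lintegral_mono hpoint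
    _ = ENNReal.ofReal (A ^ 2) * D * ∑' k, ENNReal.ofReal (b k ^ 2) *
          ∫⁻ ξ, ENNReal.ofReal ((t k ^ n)⁻¹ * w k ξ) := by
      rw [lintegral_const_mul' _ _ (ENNReal.mul_ne_top (by simp) hD),
        lintegral_tsum fun k => ((hmeas k).const_mul _).aemeasurable]
      congr 2
      ext k
      rw [lintegral_const_mul' _ _ (by simp)]
    _ ≤ ENNReal.ofReal (A ^ 2) * D * ∑' k, ENNReal.ofReal (b k ^ 2) * E := by
      gcongr with k
      exact hEle (t k) (ht1 k)
    _ = _ := by rw [ENNReal.tsum_mul_right]; ring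

/-! ### Lacunary series of bumps -/

/-- The Fourier transform of a series of Schwartz functions is the series of the Fourier transforms,
if the latter converges normally. -/
lemma HasContFourier.of_hasSum {d : ℕ} {w : 𝓢'(Eu d, ℂ)} {c : ℕ → ℂ} {s : ℕ → 𝓢(Eu d, ℂ)}
    (hw : HasSum (fun k => c k • SchwartzMap.toTemperedDistributionCLM (Eu d) ℂ volume (s k)) w)
    {B : ℕ → ℝ} (hB : Summable B) (hle : ∀ k ξ, ‖c k * 𝓕 (s k : Eu d → ℂ) ξ‖ ≤ B k) :
    HasContFourier w (fun ξ => ∑' k, c k * 𝓕 (s k : Eu d → ℂ) ξ) := by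
  have hcont : Continuous (fun ξ => ∑' k, c k * 𝓕 (s k : Eu d → ℂ) ξ) := by
    refine continuous_tsum (fun k => ?_) hB hle
    exact continuous_const.mul (𝓕 (s k) : 𝓢(Eu d, ℂ)).continuous
  refine ⟨hcont, fun ψ => ?_, fun ψ => ?_⟩
  · exact ψ.integrable.bdd_mul hcont.aestronglyMeasurable
      (ae_of_all _ fun ξ => tsum_of_norm_bounded hB.hasSum fun k => hle k ξ)
  · have hF : ∀ k, Integrable (fun ξ => c k * 𝓕 (s k : Eu d → ℂ) ξ * ψ ξ) := fun k =>
      ψ.integrable.bdd_mul (c := B k)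
        (continuous_const.mul (𝓕 (s k) : 𝓢(Eu d, ℂ)).continuous).aestronglyMeasurable
        (ae_of_all _ fun ξ => hle k ξ)
    have h1 := hasSum_integral_of_summable_integral_norm hF (by
      refine Summable.of_nonneg_of_le (fun k => integral_nonneg fun _ => norm_nonneg _)
        (fun k => ?_) (hB.mul_right (∫ ξ, ‖ψ ξ‖))
      rw [← integral_const_mul]
      refine integral_mono (hF k).norm (ψ.integrable.norm.const_mul _) fun ξ => ?_
      simp only [norm_mul (c k * _)]
      gcongr
      exact hle k ξ)
    have h2 : HasSum (fun k => c k * ∫ x, 𝓕 ψ x * s k x) (w (𝓕 ψ)) := by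
      have := hw.mapL (PointwiseConvergenceCLM.evalCLM (RingHom.id ℂ) ℂ (𝓕 ψ))
      refine this.congr_fun fun k => ?_
      change _ = c k • (SchwartzMap.toTemperedDistributionCLM (Eu d) ℂ volume (s k)) (𝓕 ψ)
      rw [SchwartzMap.toTemperedDistributionCLM_apply_apply volume]
      rfl
    have h3 : ∀ k, ∫ ξ, c k * 𝓕 (s k : Eu d → ℂ) ξ * ψ ξ = c k * ∫ x, 𝓕 ψ x * s k x := by
      intro k
      simp_rw [mul_assoc]
      rw [integral_const_mul, SchwartzMap.integral_fourier_mul_eq]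
      congr 1
      refine integral_congr_ae (ae_of_all _ fun ξ => ?_)
      simp only [SchwartzMap.fourier_coe]
      ring
    simp_rw [h3] at h1
    rw [TemperedDistribution.fourier_apply, h2.unique h1]
    simp_rw [tsum_mul_right]

/-- The coefficients that normalize, in `H^α(ℝⁿ)`, the bumps with the frequencies `2^{k+k₀}`. -/
noncomputable def lumpCoeff (α : ℝ → ℝ) (n k₀ : ℕ) (b : ℕ → ℝ) (k : ℕ) : ℝ :=
  b k * Real.sqrt (((2 : ℝ) ^ (k + k₀)) ^ n) / α (2 ^ (k + k₀))

section Series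

variable {n : ℕ} {θ : Eu n → ℂ}

lemma one_le_two_pow_real (k : ℕ) : (1 : ℝ) ≤ 2 ^ k := one_le_pow₀ (by norm_num)

/-- The function `x ↦ θ(2^{k+k₀}(x - x₀))`. -/
noncomputable def lump (hθ : ContDiff ℝ ∞ θ) (hθ' : tsupport θ ⊆ Metric.closedBall 0 2)
    (x₀ : Eu n) (k₀ k : ℕ) : 𝓢(Eu n, ℂ) :=
  HasCompactSupport.toSchwartzMap
    ((isCompact_closedBall x₀ (2 / 2 ^ (k + k₀))).of_isClosed_subset (isClosed_tsupport _)
      (tsupport_lump_subset hθ' x₀ (one_le_two_pow_real (k + k₀))))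
    (contDiff_lump hθ x₀ (2 ^ (k + k₀)))

lemma lump_apply (hθ : ContDiff ℝ ∞ θ) (hθ' : tsupport θ ⊆ Metric.closedBall 0 2)
    (x₀ : Eu n) (k₀ k : ℕ) (x : Eu n) :
    lump hθ hθ' x₀ k₀ k x = θ ((2 : ℝ) ^ (k + k₀) • (x - x₀)) := rfl

lemma summable_lumpCoeff {α : ℝ → ℝ} (h : IsRO α) (hα : 1 / 2 < lowerIndex α) (hn : 1 ≤ n)
    (k₀ : ℕ) {b : ℕ → ℝ} (hb : Summable fun k => b k ^ 2) :
    Summable (fun k => |lumpCoeff α n k₀ b k| / ((2 : ℝ) ^ (k + k₀)) ^ n) := by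
  obtain ⟨c, hc, hlow⟩ := exists_mul_rpow_le_of_lt_lowerIndex h (by norm_num) hα
  have hα1 := h.pos 1 le_rfl
  have hsum : Summable (fun k : ℕ => (c * α 1)⁻¹ * ((1 / 2 : ℝ) ^ k + b k ^ 2)) :=
    ((summable_geometric_of_lt_one (by norm_num) (by norm_num)).add hb).mul_left _
  refine Summable.of_nonneg_of_le (fun k => by positivity) (fun k => ?_) hsum
  have ht1 : (1 : ℝ) ≤ 2 ^ (k + k₀) := one_le_two_pow_real _
  have htk : (2 : ℝ) ^ k ≤ 2 ^ (k + k₀) := pow_le_pow_right₀ (by norm_num) (by omega)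
  unfold lumpCoeff
  set t : ℝ := 2 ^ (k + k₀)
  have ht0 : 0 < t := by linarith
  have hαt := h.pos t ht1
  have h1 := hlow 1 le_rfl t ht1
  rw [mul_one, ← Real.sqrt_eq_rpow] at h1
  have hsq0 : 0 < Real.sqrt t := Real.sqrt_pos.2 ht0
  have hsq : Real.sqrt t * Real.sqrt t = t := Real.mul_self_sqrt ht0.le
  have hq0 : 0 < Real.sqrt (t ^ n) := Real.sqrt_pos.2 (by positivity)
  have hq : Real.sqrt (t ^ n) * Real.sqrt (t ^ n) = t ^ n := Real.mul_self_sqrt (by positivity)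
  have hqs : Real.sqrt t ≤ Real.sqrt (t ^ n) :=
    Real.sqrt_le_sqrt (le_self_pow₀ ht1 (by omega))
  have hbk : |b k| ≤ 1 + b k ^ 2 := by nlinarith [sq_nonneg (|b k| - 1), sq_abs (b k)]
  rw [abs_div, abs_mul, abs_of_pos hq0, abs_of_pos hαt]
  calc |b k| * Real.sqrt (t ^ n) / α t / t ^ n = |b k| / (α t * Real.sqrt (t ^ n)) := by
        generalize Real.sqrt (t ^ n) = q at hq hq0 ⊢
        rw [← hq]
        field_simp
    _ ≤ |b k| / (c * Real.sqrt t * α 1 * Real.sqrt t) := by gcongr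
    _ = (c * α 1)⁻¹ * (|b k| / t) := by
        generalize Real.sqrt t = q at hsq hsq0 ⊢
        rw [← hsq]
        field_simp
    _ ≤ (c * α 1)⁻¹ * ((1 + b k ^ 2) / t) := by gcongr
    _ ≤ (c * α 1)⁻¹ * ((1 / 2 : ℝ) ^ k + b k ^ 2) := by
        gcongr
        rw [add_div]
        gcongr
        · rw [one_div_pow]
          gcongr
        · exact div_le_self (sq_nonneg _) ht1

/-- A lacunary series of Schwartz functions whose Fourier transforms are localized as those of bumps
has a continuous Fourier transform, and its norm in `H^α` is controlled by the `ℓ²`-norm of the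
normalized coefficients. -/
lemma exists_hasContFourier_lacunary {α : ℝ → ℝ} (h : IsRO α) (hα : 1 / 2 < lowerIndex α)
    (hn : 1 ≤ n) (k₀ : ℕ) :
    ∃ M : ℕ, ∀ C : ℝ, 0 ≤ C → ∃ E : ℝ≥0∞, E ≠ ⊤ ∧ ∀ s : ℕ → 𝓢(Eu n, ℂ),
      (∀ k ξ, ‖𝓕 (s k : Eu n → ℂ) ξ‖ ≤ C / ((2 : ℝ) ^ (k + k₀)) ^ n ∧
        (Real.sqrt (1 + ‖ξ‖ ^ 2) / 2 ^ (k + k₀)) ^ M * ‖𝓕 (s k : Eu n → ℂ) ξ‖ ≤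
          C / ((2 : ℝ) ^ (k + k₀)) ^ n) →
      ∀ b : ℕ → ℝ, (Summable fun k => b k ^ 2) → ∀ w : 𝓢'(Eu n, ℂ),
        HasSum (fun k => (lumpCoeff α n k₀ b k : ℂ) •
          SchwartzMap.toTemperedDistributionCLM (Eu n) ℂ volume (s k)) w →
        ∃ g, HasContFourier w g ∧ weightedSq α g ≤ E * ∑' k, ENNReal.ofReal (b k ^ 2) := by
  obtain ⟨M, hM⟩ := exists_weightedSq_tsum_le h hα n k₀
  refine ⟨M, fun C hC => ?_⟩
  obtain ⟨E, hE, hEle⟩ := hM C hC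
  refine ⟨E, hE, fun s hs b hb w hw => ⟨_, ?_, hEle _ hs b⟩⟩
  refine HasContFourier.of_hasSum hw ((summable_lumpCoeff h hα hn k₀ hb).mul_right C) fun k ξ => ?_
  change ‖(lumpCoeff α n k₀ b k : ℂ) * _‖ ≤ |lumpCoeff α n k₀ b k| / _ * C
  rw [norm_mul, Complex.norm_real, Real.norm_eq_abs]
  exact (mul_le_mul_of_nonneg_left (hs k ξ).1 (abs_nonneg _)).trans (le_of_eq (by ring))

/-- The lacunary series `∑ c_k θ(2^{k+k₀}(x - x₀))` with normalized coefficients from `ℓ²` converges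
in the sense of distributions, and its sum belongs to `H^α`, globally and locally. -/
lemma exists_lump_series {α : ℝ → ℝ} (h : IsRO α) (hα : 1 / 2 < lowerIndex α) (hn : 1 ≤ n)
    (hθ : ContDiff ℝ ∞ θ) (hθ' : tsupport θ ⊆ Metric.closedBall 0 2) (x₀ : Eu n) (k₀ : ℕ) :
    ∃ E : ℝ≥0∞, E ≠ ⊤ ∧ ∀ b : ℕ → ℝ, (Summable fun k => b k ^ 2) → ∃ w : 𝓢'(Eu n, ℂ),
      HasSum (fun k => (lumpCoeff α n k₀ b k : ℂ) •
        SchwartzMap.toTemperedDistributionCLM (Eu n) ℂ volume (lump hθ hθ' x₀ k₀ k)) w ∧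
      MemHContLoc α 0 w ∧
      ∃ g, HasContFourier w g ∧ weightedSq α g ≤ E * ∑' k, ENNReal.ofReal (b k ^ 2) := by
  obtain ⟨M, hM⟩ := exists_hasContFourier_lacunary h hα hn k₀
  obtain ⟨C, hC0, hC⟩ := exists_fourier_lump_le (S := fun _ => 1) contDiff_const hθ hθ' x₀ M
  obtain ⟨E, hE, hEle⟩ := hM C hC0
  refine ⟨E, hE, fun b hb => ?_⟩
  obtain ⟨C₁, hC₁, hint⟩ :=
    exists_integral_iteratedFDeriv_lump_le (S := fun _ => 1) contDiff_const hθ hθ' x₀ 0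
  -- the series converges absolutely in `L¹`
  have hL : Summable (fun k => (lumpCoeff α n k₀ b k : ℂ) •
      (lump hθ hθ' x₀ k₀ k).toLp 1 volume) := by
    refine Summable.of_norm_bounded ((summable_lumpCoeff h hα hn k₀ hb).mul_right C₁) fun k => ?_
    rw [norm_smul, SchwartzMap.norm_toLp_one, Complex.norm_real, Real.norm_eq_abs,
      div_mul_eq_mul_div, mul_div_assoc]
    gcongr
    simpa [lump_apply] using (hint _ (one_le_two_pow_real (k + k₀))).2
  have hsum := hL.hasSum.mapL (Lp.toTemperedDistributionCLM ℂ (volume : Measure (Eu n)) 1)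
  set w := Lp.toTemperedDistributionCLM ℂ (volume : Measure (Eu n)) 1
    (∑' k, (lumpCoeff α n k₀ b k : ℂ) • (lump hθ hθ' x₀ k₀ k).toLp 1 volume)
  have hw : HasSum (fun k => (lumpCoeff α n k₀ b k : ℂ) •
        SchwartzMap.toTemperedDistributionCLM (Eu n) ℂ volume (lump hθ hθ' x₀ k₀ k)) w := by
    refine hsum.congr_fun fun k => ?_
    rw [map_smul, Lp.toTemperedDistributionCLM_apply, Lp.toTemperedDistribution_toLp_eq]
  refine ⟨w, hw, fun S hS hS' => ?_, ?_⟩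
  · obtain ⟨C₂, hC₂, hS2⟩ := exists_fourier_lump_le hS hθ hθ' x₀ M
    obtain ⟨E₂, hE₂, hEle₂⟩ := hM C₂ hC₂
    have hST := hS'.hasTemperateGrowth hS
    have hcoe : ∀ k, (SchwartzMap.smulLeftCLM ℂ S (lump hθ hθ' x₀ k₀ k) : Eu n → ℂ) =
        fun x => S x * θ ((2 : ℝ) ^ (k + k₀) • (x - x₀)) := fun k => by
      ext x
      rw [SchwartzMap.smulLeftCLM_apply_apply hST, lump_apply, smul_eq_mul]
    have hwS := hw.mapL (TemperedDistribution.smulLeftCLM ℂ S)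
    obtain ⟨g, hg, hgα⟩ := hEle₂ (fun k => SchwartzMap.smulLeftCLM ℂ S (lump hθ hθ' x₀ k₀ k))
      (fun k ξ => by
        rw [hcoe]
        exact hS2 _ (one_le_two_pow_real (k + k₀)) ξ) b hb _ (by
        refine hwS.congr_fun fun k => ?_
        rw [map_smul]
        congr 1
        ext ψ
        rw [TemperedDistribution.smulLeftCLM_apply_apply,
          SchwartzMap.toTemperedDistributionCLM_apply_apply volume,
          SchwartzMap.toTemperedDistributionCLM_apply_apply volume]
        refine integral_congr_ae (ae_of_all _ fun x => ?_)
        simp only [SchwartzMap.smulLeftCLM_apply_apply hST, smul_eq_mul]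
        ring)
    refine ⟨g, hg, ?_⟩
    have : mulRho α (-((0 : ℕ) : ℝ)) = α := by
      ext t
      simp [mulRho]
    rw [this]
    exact hgα.trans_lt (ENNReal.mul_lt_top hE₂.lt_top hb.tsum_ofReal_lt_top)
  · refine hEle (lump hθ hθ' x₀ k₀) (fun k ξ => ?_) b hb w hw
    have h1 : (lump hθ hθ' x₀ k₀ k : Eu n → ℂ) =
        fun x => 1 * θ ((2 : ℝ) ^ (k + k₀) • (x - x₀)) := by
      ext x
      rw [lump_apply, one_mul]
    rw [h1]
    exact hC _ (one_le_two_pow_real (k + k₀)) ξ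

end Series

/-! ### Failure of differentiability -/

/-- The function that equals `y_i^p` near the origin and vanishes for `|y| ≥ 3/2`. -/
noncomputable def monomialBump {n : ℕ} (i : Fin n) (p : ℕ) (y : Eu n) : ℂ :=
  (((⟨1, 3 / 2, one_pos, by norm_num⟩ : ContDiffBump (0 : Eu n)) y * y i ^ p : ℝ) : ℂ)

section MonomialBump

variable {n : ℕ} (i : Fin n) (p : ℕ)

lemma contDiff_monomialBump : ContDiff ℝ ∞ (monomialBump i p) := by
  refine Complex.ofRealCLM.contDiff.comp (ContDiff.mul (ContDiffBump.contDiff _) ?_)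
  exact (EuclideanSpace.proj (𝕜 := ℝ) i).contDiff.pow p

lemma monomialBump_of_le {y : Eu n} (hy : ‖y‖ ≤ 1) : monomialBump i p y = (y i : ℂ) ^ p := by
  rw [monomialBump, ContDiffBump.one_of_mem_closedBall _ (by simpa using hy)]
  simp

lemma monomialBump_of_ge {y : Eu n} (hy : 3 / 2 ≤ ‖y‖) : monomialBump i p y = 0 := by
  rw [monomialBump, ContDiffBump.zero_of_le_dist _ (by simpa using hy)]
  simp

lemma tsupport_monomialBump_subset : tsupport (monomialBump i p) ⊆ Metric.closedBall 0 2 := by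
  refine closure_minimal (fun y hy => ?_) Metric.isClosed_closedBall
  by_contra h
  rw [mem_closedBall_zero_iff, not_le] at h
  exact hy (monomialBump_of_ge i p (by linarith))

end MonomialBump

/-- A function that is `C^p` at `x₀` cannot coincide with `C_N (x - x₀)_i^p` on annuli shrinking to
`x₀` if `C_N → ∞`: its derivative `∂_i^p` takes there the value `p! C_N`. -/
lemma not_contDiffAt_of_eqOn_annuli {n : ℕ} (i : Fin n) (p k₀ : ℕ) {x₀ : Eu n} {f : Eu n → ℂ}
    {C : ℕ → ℝ} (hC : Tendsto C atTop atTop)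
    (hf : ∀ N : ℕ, ∀ x, 3 / 4 < 2 ^ (N + k₀) * ‖x - x₀‖ → 2 ^ (N + k₀) * ‖x - x₀‖ < 1 →
      f x = (C N : ℂ) * ((x - x₀) i : ℂ) ^ p) : ¬ ContDiffAt ℝ p f x₀ := by
  intro hcd
  set e : Eu n := EuclideanSpace.single i (1 : ℝ) with he
  set γ : ℝ → Eu n := fun s => x₀ + s • e with hγ
  set h : ℝ → ℝ := fun s => (f (γ s)).re with hh
  have hγ0 : γ 0 = x₀ := by simp [hγ]
  have hcdh : ContDiffAt ℝ p h 0 := by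
    have h1 : ContDiffAt ℝ p f (γ 0) := by rwa [hγ0]
    have h2 : ContDiffAt ℝ p γ 0 := by
      simp only [hγ]
      fun_prop
    exact Complex.reCLM.contDiff.contDiffAt.comp (0 : ℝ) (h1.comp (0 : ℝ) h2)
  -- points of the annuli that tend to `x₀` along the `i`-th axis
  set s : ℕ → ℝ := fun N => 7 / 8 / 2 ^ (N + k₀) with hs
  have hs0 : Tendsto s atTop (𝓝 0) := by
    have h1 : Tendsto (fun N : ℕ => (2 : ℝ) ^ (N + k₀)) atTop atTop :=
      (tendsto_pow_atTop_atTop_of_one_lt one_lt_two).comp (tendsto_add_atTop_nat k₀)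
    exact h1.const_div_atTop _
  have hval : ∀ N, iteratedDeriv p h (s N) = C N * p.factorial := by
    intro N
    have hT : (0 : ℝ) < 2 ^ (N + k₀) := by positivity
    have hev : h =ᶠ[𝓝 (s N)] fun y => C N * y ^ p := by
      have hopen : IsOpen {y : ℝ | 3 / 4 < 2 ^ (N + k₀) * |y| ∧ 2 ^ (N + k₀) * |y| < 1} :=
        (isOpen_lt continuous_const (by fun_prop)).and (isOpen_lt (by fun_prop) continuous_const)
      refine Filter.eventuallyEq_of_mem (hopen.mem_nhds ?_) ?_
      · have : 2 ^ (N + k₀) * |s N| = 7 / 8 := by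
          rw [abs_of_pos (by positivity)]
          simp only [hs]
          field_simp
        simp only [mem_ofPred_eq, this]
        norm_num
      · intro y hy
        have h1 : γ y - x₀ = y • e := by simp [hγ]
        have h2 : ‖γ y - x₀‖ = |y| := by simp [h1, norm_smul, he]
        have h3 := hf N (γ y) (by rw [h2]; exact hy.1) (by rw [h2]; exact hy.2)
        have h4 : (y • e) i = y := by simp [he]
        simp only [hh, h3, h1, h4]
        rw [← Complex.ofReal_pow, ← Complex.ofReal_mul, Complex.ofReal_re]
    rw [hev.iteratedDeriv_eq, iteratedDeriv_const_mul_field, iteratedDeriv_pow]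
    simp [Nat.descFactorial_self]
  have hcont : ContinuousAt (fun y => ‖iteratedFDeriv ℝ p h y‖) 0 :=
    (hcdh.iteratedFDeriv_right (m := 0) (by simp)).continuousAt.norm
  have hlim : Tendsto (fun N => |C N| * p.factorial) atTop
      (𝓝 ‖iteratedFDeriv ℝ p h 0‖) := by
    refine (hcont.tendsto.comp hs0).congr fun N => ?_
    simp only [Function.comp_apply, norm_iteratedFDeriv_eq_norm_iteratedDeriv, hval,
      Real.norm_eq_abs, abs_mul, Nat.abs_cast]
  have hinf : Tendsto (fun N => |C N| * p.factorial) atTop atTop :=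
    (tendsto_abs_atTop_atTop.comp hC).atTop_mul_const (by exact_mod_cast p.factorial_pos)
  exact not_tendsto_nhds_of_tendsto_atTop hinf _ hlim

/-- Suppose that the restriction to `W` of a lacunary series of bumps `y_i^p` is the function `f`.
On the annulus where `2^{N+k₀}|x - x₀|` is between `3/4` and `1`, the bumps up to the `N`-th are
monomials and the other ones vanish. -/
lemma eq_monomial_on_annulus {n : ℕ} (i : Fin n) (p k₀ : ℕ) {x₀ : Eu n} {c : ℕ → ℝ}
    {w : 𝓢'(Eu n, ℂ)}
    (hw : HasSum (fun k => (c k : ℂ) • SchwartzMap.toTemperedDistributionCLM (Eu n) ℂ volume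
      (lump (contDiff_monomialBump i p) (tsupport_monomialBump_subset i p) x₀ k₀ k)) w)
    {f : Eu n → ℂ} {W : Set (Eu n)} (hW : Metric.closedBall x₀ (2 / 2 ^ k₀) ⊆ W)
    (hf : ContinuousOn f W)
    (hwf : ∀ ψ : 𝓢(Eu n, ℂ), HasCompactSupport ψ → tsupport ψ ⊆ W → w ψ = ∫ x, f x * ψ x)
    (N : ℕ) {x : Eu n} (hx1 : 3 / 4 < 2 ^ (N + k₀) * ‖x - x₀‖)
    (hx2 : 2 ^ (N + k₀) * ‖x - x₀‖ < 1) :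
    f x = ((∑ k ∈ Finset.range (N + 1), c k * ((2 : ℝ) ^ (k + k₀)) ^ p : ℝ) : ℂ) *
      ((x - x₀) i : ℂ) ^ p := by
  set T : ℝ := 2 ^ (N + k₀) with hT
  have hT0 : 0 < T := by positivity
  set O : Set (Eu n) := {x | 3 / 4 < T * ‖x - x₀‖ ∧ T * ‖x - x₀‖ < 1} with hO
  have hOopen : IsOpen O :=
    (isOpen_lt continuous_const (by fun_prop)).and (isOpen_lt (by fun_prop) continuous_const)
  have hOW : O ⊆ W := by
    intro y hy
    apply hW
    rw [Metric.mem_closedBall, dist_eq_norm, le_div_iff₀ (by positivity)]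
    have h1 : (2 : ℝ) ^ k₀ ≤ T := pow_le_pow_right₀ (by norm_num) (by omega)
    nlinarith [hy.2, norm_nonneg (y - x₀)]
  set Q : Eu n → ℂ := fun x =>
    ((∑ k ∈ Finset.range (N + 1), c k * ((2 : ℝ) ^ (k + k₀)) ^ p : ℝ) : ℂ) *
      ((x - x₀) i : ℂ) ^ p with hQ
  have hQc : Continuous Q := by
    simp only [hQ]
    fun_prop
  have hlump : ∀ k, ∀ y ∈ O,
      lump (contDiff_monomialBump i p) (tsupport_monomialBump_subset i p) x₀ k₀ k y =
        if k < N + 1 then ((((2 : ℝ) ^ (k + k₀)) ^ p : ℝ) : ℂ) * ((y - x₀) i : ℂ) ^ p else 0 := by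
    intro k y hy
    have hk0 : (0 : ℝ) < 2 ^ (k + k₀) := by positivity
    have hnorm : ‖(2 : ℝ) ^ (k + k₀) • (y - x₀)‖ = 2 ^ (k + k₀) * ‖y - x₀‖ := by
      rw [norm_smul, Real.norm_of_nonneg hk0.le]
    rw [lump_apply]
    split_ifs with hk
    · rw [monomialBump_of_le]
      · simp [mul_pow]
      · rw [hnorm]
        have h1 : (2 : ℝ) ^ (k + k₀) ≤ T := pow_le_pow_right₀ (by norm_num) (by omega)
        nlinarith [hy.2, norm_nonneg (y - x₀)]
    · rw [monomialBump_of_ge]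
      rw [hnorm]
      have h1 : 2 * T ≤ (2 : ℝ) ^ (k + k₀) := by
        rw [hT, ← pow_succ']
        exact pow_le_pow_right₀ (by norm_num) (by omega)
      nlinarith [hy.1, norm_nonneg (y - x₀)]
  have hae : ∀ᵐ y, y ∈ O → f y - Q y = 0 := by
    refine hOopen.ae_eq_zero_of_integral_contDiff_smul_eq_zero
      (((hf.mono hOW).sub hQc.continuousOn).locallyIntegrableOn hOopen.measurableSet)
      fun g hg hgc hgO => ?_
    have hgc' : HasCompactSupport (fun y => (g y : ℂ)) := hgc.comp_left Complex.ofReal_zero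
    have hgs : ContDiff ℝ ∞ (fun y => (g y : ℂ)) := Complex.ofRealCLM.contDiff.comp hg
    have hgO' : tsupport (fun y => (g y : ℂ)) ⊆ O := by
      refine (closure_mono fun y hy => ?_).trans hgO
      simpa using hy
    have hg0 : ∀ y, y ∉ O → g y = 0 := fun y hy => by
      by_contra h0
      exact hy (hgO (subset_tsupport g h0))
    set ψ : 𝓢(Eu n, ℂ) := hgc'.toSchwartzMap hgs with hψ
    have hψa : ∀ y, ψ y = g y := fun y => rfl
    have h1 : w ψ = ∫ y, f y * ψ y := hwf ψ hgc' (hgO'.trans hOW)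
    have hsum := hw.mapL (PointwiseConvergenceCLM.evalCLM (RingHom.id ℂ) ℂ ψ)
    have hterm : ∀ k, PointwiseConvergenceCLM.evalCLM (RingHom.id ℂ) ℂ ψ
        ((c k : ℂ) • SchwartzMap.toTemperedDistributionCLM (Eu n) ℂ volume
          (lump (contDiff_monomialBump i p) (tsupport_monomialBump_subset i p) x₀ k₀ k)) =
        if k < N + 1 then ((c k * ((2 : ℝ) ^ (k + k₀)) ^ p : ℝ) : ℂ) *
          ∫ y, ((y - x₀) i : ℂ) ^ p * g y else 0 := by
      intro k
      change (c k : ℂ) • SchwartzMap.toTemperedDistributionCLM (Eu n) ℂ volume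
          (lump (contDiff_monomialBump i p) (tsupport_monomialBump_subset i p) x₀ k₀ k) ψ = _
      rw [SchwartzMap.toTemperedDistributionCLM_apply_apply volume]
      have h2 : ∀ y, ψ y •
          lump (contDiff_monomialBump i p) (tsupport_monomialBump_subset i p) x₀ k₀ k y =
          if k < N + 1 then ((((2 : ℝ) ^ (k + k₀)) ^ p : ℝ) : ℂ) *
            (((y - x₀) i : ℂ) ^ p * g y) else 0 := by
        intro y
        rw [hψa, smul_eq_mul]
        by_cases hy : y ∈ O
        · rw [hlump k y hy]
          split_ifs <;> ring
        · simp [hg0 y hy]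
      simp_rw [h2]
      split_ifs
      · rw [integral_const_mul, smul_eq_mul]
        push_cast
        ring
      · simp
    have hfin : w ψ = ∑ k ∈ Finset.range (N + 1), ((c k * ((2 : ℝ) ^ (k + k₀)) ^ p : ℝ) : ℂ) *
        ∫ y, ((y - x₀) i : ℂ) ^ p * g y := by
      refine hsum.unique ?_
      have := hasSum_sum_of_ne_finset_zero (L := .unconditional ℕ) (s := Finset.range (N + 1))
        (f := fun k => PointwiseConvergenceCLM.evalCLM (RingHom.id ℂ) ℂ ψ
        ((c k : ℂ) • SchwartzMap.toTemperedDistributionCLM (Eu n) ℂ volume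
          (lump (contDiff_monomialBump i p) (tsupport_monomialBump_subset i p) x₀ k₀ k)))
        (fun k hk => by
          rw [hterm, if_neg (by simpa using hk)])
      rw [Finset.sum_congr rfl fun k hk => by
        rw [hterm, if_pos (Finset.mem_range.1 hk)]] at this
      exact this
    have hQint : ∫ y, Q y * g y = w ψ := by
      rw [hfin, ← Finset.sum_mul, ← integral_const_mul]
      refine integral_congr_ae (ae_of_all _ fun y => ?_)
      simp only [hQ]
      push_cast
      ring
    have hcs : ∀ F : Eu n → ℂ, ContinuousOn F O → Integrable (fun y => F y * g y) := by
      intro F hF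
      have hcont : Continuous (fun y => F y * (g y : ℂ)) := by
        rw [continuous_iff_continuousAt]
        intro y
        by_cases hy : y ∈ tsupport (fun y => (g y : ℂ))
        · exact (hF.continuousAt (hOopen.mem_nhds (hgO' hy))).mul hgs.continuous.continuousAt
        · have : (fun y => F y * (g y : ℂ)) =ᶠ[𝓝 y] fun _ => 0 := by
            filter_upwards [notMem_tsupport_iff_eventuallyEq.1 hy] with z hz
            have hz' : (g z : ℂ) = 0 := hz
            rw [hz', mul_zero]
          exact continuousAt_const.congr this.symm
      exact hcont.integrable_of_hasCompactSupport hgc'.mul_left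
    have h3 : ∀ y, g y • (f y - Q y) = f y * g y - Q y * g y := fun y => by
      rw [Complex.real_smul]
      ring
    simp_rw [h3]
    rw [integral_sub (hcs f (hf.mono hOW)) (hcs Q hQc.continuousOn), hQint, h1]
    exact sub_self _
  have heq : EqOn f Q O := by
    refine Measure.eqOn_open_of_ae_eq (μ := volume) ?_ hOopen (hf.mono hOW) hQc.continuousOn
    rw [Filter.EventuallyEq, ae_restrict_iff' hOopen.measurableSet]
    filter_upwards [hae] with y hy hyO using sub_eq_zero.1 (hy hyO)
  exact heq ⟨hx1, hx2⟩

/-! ### Approximation by partial sums -/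

/-- The partial sums of a series of bumps with coefficients normalized in `H^α` converge in `H^α`:
the remainder is a series of the same kind. -/
lemma exists_lump_series_tendsto {α : ℝ → ℝ} (h : IsRO α) (hα : 1 / 2 < lowerIndex α) {n : ℕ}
    (hn : 1 ≤ n) {θ : Eu n → ℂ} (hθ : ContDiff ℝ ∞ θ)
    (hθ' : tsupport θ ⊆ Metric.closedBall 0 2) (x₀ : Eu n) (k₀ : ℕ) {b : ℕ → ℝ}
    (hb : Summable fun k => b k ^ 2) :
    ∃ w : 𝓢'(Eu n, ℂ),
      HasSum (fun k => (lumpCoeff α n k₀ b k : ℂ) •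
        SchwartzMap.toTemperedDistributionCLM (Eu n) ℂ volume (lump hθ hθ' x₀ k₀ k)) w ∧
      MemHContLoc α 0 w ∧ MemH α w ∧
      ∃ ε : ℕ → ℝ≥0∞, Tendsto ε atTop (𝓝 0) ∧ ∀ N, ∃ g, HasContFourier
        (SchwartzMap.toTemperedDistributionCLM (Eu n) ℂ volume
          (∑ k ∈ Finset.range N, (lumpCoeff α n k₀ b k : ℂ) • lump hθ hθ' x₀ k₀ k) - w) g ∧
        weightedSq α g ≤ ε N ∧ ε N < ⊤ := by
  obtain ⟨E, hE, hE'⟩ := exists_lump_series h hα hn hθ hθ' x₀ k₀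
  obtain ⟨w, hw, hloc, g, hg, hgα⟩ := hE' b hb
  refine ⟨w, hw, hloc, ⟨g, hg.hasFourierFunction,
    hgα.trans_lt (ENNReal.mul_lt_top hE.lt_top hb.tsum_ofReal_lt_top)⟩,
    fun N => E * ∑' k, ENNReal.ofReal (b (k + N) ^ 2), ?_, fun N => ?_⟩
  · have := ENNReal.Tendsto.const_mul (a := E)
      (ENNReal.tendsto_sum_nat_add (fun k => ENNReal.ofReal (b k ^ 2)) hb.tsum_ofReal_ne_top)
      (Or.inr hE)
    simpa using this
  · set b' : ℕ → ℝ := fun k => if k < N then 0 else -b k with hb'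
    have hle : ∀ k, b' k ^ 2 ≤ b k ^ 2 := fun k => by
      simp only [hb']
      split_ifs
      · simpa using sq_nonneg (b k)
      · rw [neg_sq]
    have hbs : Summable fun k => b' k ^ 2 :=
      Summable.of_nonneg_of_le (fun k => sq_nonneg _) hle hb
    have hshift : Summable fun k => b (k + N) ^ 2 := (summable_nat_add_iff N).2 hb
    obtain ⟨w', hw', -, g', hg', hgα'⟩ := hE' b' hbs
    have hsum : ∑' k, ENNReal.ofReal (b' k ^ 2) = ∑' k, ENNReal.ofReal (b (k + N) ^ 2) := by
      rw [← ENNReal.summable.sum_add_tsum_nat_add' (k := N)]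
      rw [Finset.sum_eq_zero fun k hk => by simp [hb', Finset.mem_range.1 hk], zero_add]
      simp [hb']
    have hfin := hasSum_sum_of_ne_finset_zero (L := .unconditional ℕ) (s := Finset.range N)
      (f := fun k => if k < N then (lumpCoeff α n k₀ b k : ℂ) •
        SchwartzMap.toTemperedDistributionCLM (Eu n) ℂ volume (lump hθ hθ' x₀ k₀ k) else 0)
      (fun k hk => if_neg (by simpa using hk))
    have hww : w' = SchwartzMap.toTemperedDistributionCLM (Eu n) ℂ volume
          (∑ k ∈ Finset.range N, (lumpCoeff α n k₀ b k : ℂ) • lump hθ hθ' x₀ k₀ k) - w := by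
      have h1 := hfin.sub hw
      rw [Finset.sum_congr rfl fun k hk => if_pos (Finset.mem_range.1 hk)] at h1
      simp_rw [← map_smul] at h1
      rw [← map_sum] at h1
      refine hw'.unique (h1.congr_fun fun k => ?_)
      simp only [hb', lumpCoeff]
      split_ifs
      · simp
      · rw [map_smul, zero_sub, ← neg_smul]
        congr 1
        push_cast
        ring
    rw [hww] at hg'
    rw [hsum] at hgα'
    exact ⟨g', hg', hgα', ENNReal.mul_lt_top hE.lt_top hshift.tsum_ofReal_lt_top⟩

lemma hNormDomain_le {n : ℕ} {Ω : Opens (Eu n)} {α : ℝ → ℝ} {T : 𝓓(Ω, ℂ) → ℂ}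
    {w : 𝓢'(Eu n, ℂ)} {g : Eu n → ℂ} (hg : HasContFourier w g) (hα : weightedSq α g < ⊤)
    (hT : IsRestriction Ω w T) : hNormDomain Ω α T ≤ weightedSq α g ^ (1 / 2 : ℝ) :=
  (iInf₂_le w ⟨⟨g, hg.hasFourierFunction, hα⟩, hT⟩).trans (iInf₂_le g hg.hasFourierFunction)

/-! ### Locality of differential operators -/

lemma Dmulti_eventuallyEq_zero {n : ℕ} (μ : Fin n → ℕ) {u : Eu n → ℂ} {x : Eu n}
    (hu : u =ᶠ[𝓝 x] 0) : Dmulti μ u =ᶠ[𝓝 x] 0 := by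
  have step : ∀ (k : Fin n) (v : Eu n → ℂ), v =ᶠ[𝓝 x] 0 → Dpart k v =ᶠ[𝓝 x] 0 := by
    intro k v hv
    filter_upwards [hv.fderiv (𝕜 := ℝ)] with y hy
    rw [Dpart, hy]
    simp
  have iter : ∀ (k : Fin n) (j : ℕ) (v : Eu n → ℂ), v =ᶠ[𝓝 x] 0 → (Dpart k)^[j] v =ᶠ[𝓝 x] 0 := by
    intro k j v hv
    induction j with
    | zero => exact hv
    | succ j ih =>
      rw [Function.iterate_succ_apply']
      exact step k _ ih
  unfold Dmulti
  induction List.finRange n with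
  | nil => exact hu
  | cons k l ih => exact iter k (μ k) _ ih

lemma diffOp_eq_zero {n : ℕ} (l : ℕ) (c : (Fin n → ℕ) → Eu n → ℂ) {u : Eu n → ℂ} {x : Eu n}
    (hu : u =ᶠ[𝓝 x] 0) : diffOp l c u x = 0 :=
  Finset.sum_eq_zero fun _ _ => Finset.sum_eq_zero fun μ _ => by
    rw [(Dmulti_eventuallyEq_zero μ hu).self_of_nhds]
    simp

lemma diffOp_congr {n : ℕ} (l : ℕ) {c c' : (Fin n → ℕ) → Eu n → ℂ} (u : Eu n → ℂ) {x : Eu n}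
    (h : ∀ μ, c μ x = c' μ x) : diffOp l c u x = diffOp l c' u x := by
  simp [diffOp, h]

/-! ### The zero distribution on the boundary -/

lemma isBdDistr_zero {n : ℕ} {Γ : Set (Eu n)} : IsBdDistr (0 : BdSmooth Γ →ₗ[ℂ] ℂ) :=
  ⟨0, 0, fun _ _ _ _ => by simp⟩

lemma memHBdLoc_zero {n : ℕ} {Γ : Set (Eu n)} (V : Set (Eu n)) (α : ℝ → ℝ) :
    MemHBdLoc V α (0 : BdSmooth Γ →ₗ[ℂ] ℂ) := by
  refine ⟨isBdDistr_zero, fun χ _ => ?_⟩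
  have : bdMul χ (0 : BdSmooth Γ →ₗ[ℂ] ℂ) = 0 := LinearMap.zero_comp _
  rw [this]
  exact ⟨isBdDistr_zero, fun 𝔄 j => ⟨0, fun ψ F _ _ => rfl, MemHCont.zero.memH⟩⟩

/-! ### The local smoothness of the image -/

/-- A function that is smooth near a bounded set `S` coincides on `S` with one from `C₀^∞(ℝⁿ)`. -/
lemma exists_contDiff_hasCompactSupport_eqOn {n : ℕ} {S : Set (Eu n)}
    (hS : Bornology.IsBounded S) {F : Eu n → ℂ} (hF : ContDiff ℝ ∞ F) :
    ∃ F' : Eu n → ℂ, ContDiff ℝ ∞ F' ∧ HasCompactSupport F' ∧ EqOn F' F S := by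
  obtain ⟨R, hR⟩ := hS.subset_closedBall 0
  let ζ : ContDiffBump (0 : Eu n) :=
    ⟨max R 1, max R 1 + 1, lt_max_of_lt_right one_pos, lt_add_one _⟩
  have hζ : HasCompactSupport (fun x => (ζ x : ℂ)) := ζ.hasCompactSupport.comp_left Complex.ofReal_zero
  refine ⟨fun x => (ζ x : ℂ) * F x, (Complex.ofRealCLM.contDiff.comp ζ.contDiff).mul hF,
    hζ.mul_right, fun x hx => ?_⟩
  have h1 : ζ x = 1 := ζ.one_of_mem_closedBall
    (Metric.closedBall_subset_closedBall (le_max_left _ _) (hR hx))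
  simp [h1]

lemma toSchwartz_apply_eq_zero {n : ℕ} {Ω : Opens (Eu n)} (ψ : 𝓓(Ω, ℂ)) {x : Eu n}
    (hx : x ∉ (Ω : Set (Eu n))) : toSchwartz ψ x = 0 := by
  by_contra h
  exact hx (ψ.tsupport_subset (subset_tsupport ψ h))

/-- If `w` belongs to `H^{αρ^{-s}}` locally, its restriction to a bounded open set `Ω` is locally in
`H^{αρ^{-s}}` up to the boundary. -/
lemma MemHContLoc.memHLoc {n : ℕ} {Ω : Opens (Eu n)} (hΩ : Bornology.IsBounded (Ω : Set (Eu n)))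
    (V : Set (Eu n)) {α : ℝ → ℝ} {s : ℕ} {w : 𝓢'(Eu n, ℂ)} (hw : MemHContLoc α s w) :
    MemHLoc Ω V (mulRho α (-(s : ℝ))) (restrictDistr Ω w) := by
  intro χ hχ _
  obtain ⟨χ', hχ', hc, heq⟩ := exists_contDiff_hasCompactSupport_eqOn hΩ hχ
  refine ⟨TemperedDistribution.smulLeftCLM ℂ χ' w, (hw χ' hχ' hc).memH, fun ψ => ?_⟩
  rw [TemperedDistribution.smulLeftCLM_apply_apply]
  change w _ = w (toSchwartz (smoothMul χ hχ ψ))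
  congr 1
  ext x
  rw [SchwartzMap.smulLeftCLM_apply_apply (hc.hasTemperateGrowth hχ')]
  change χ' x * toSchwartz ψ x = χ x * toSchwartz ψ x
  by_cases hx : x ∈ (Ω : Set (Eu n))
  · rw [heq hx]
  · rw [toSchwartz_apply_eq_zero ψ hx, mul_zero, mul_zero]

end ExtendedSobolev

open ExtendedSobolev
theorem mainTheorem6 {n q : ℕ} (hn : 2 ≤ n) (hq : 1 ≤ q)
    (Ω : Opens (Eu n)) (hΩ : IsSmoothBoundedDomain Ω)
    (P : BVP n q) (hP : P.IsElliptic Ω)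
    (V : Set (Eu n)) (hV : IsOpen V) (hΩV : ((Ω : Set (Eu n)) ∩ V).Nonempty)
    (p : ℕ) (φ : ℝ → ℝ) (hφ : IsRO φ) (hσ : (P.maxOrder : ℝ) + 1 / 2 < lowerIndex φ)
    (himp : ∀ (u f : Distr Ω)
        (g : Fin q → BdSmooth (frontier (Ω : Set (Eu n))) →ₗ[ℂ] ℂ),
      MemHPlus Ω ((P.maxOrder : ℝ) + 1 / 2) u →
      P.IsImage Ω u f g →
      MemHLoc Ω V (mulRho φ (-(2 * q : ℝ))) f →
      (∀ j, MemHBdLoc V (mulRho φ (-(P.m j : ℝ) - 1 / 2)) (g j)) →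
      MemCLoc Ω V p u) :
    IntegrableOn (fun t : ℝ => t ^ (2 * p + n - 1) * (φ t ^ 2)⁻¹) (Ioi 1) := by
  have hσ' : 1 / 2 < lowerIndex φ := by
    have : (0 : ℝ) ≤ P.maxOrder := Nat.cast_nonneg _
    linarith
  -- a ball in `Ω ∩ V`, and the frequency `2^k₀` from which on the bumps are supported there
  obtain ⟨x₀, hx₀⟩ := hΩV
  have hopen : IsOpen ((Ω : Set (Eu n)) ∩ V) := Ω.isOpen.inter hV
  obtain ⟨r, hr0, hr⟩ := Metric.nhds_basis_closedBall.mem_iff.1 (hopen.mem_nhds hx₀)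
  obtain ⟨k₀, hk₀⟩ : ∃ k₀ : ℕ, 2 / (2 : ℝ) ^ k₀ ≤ r := by
    obtain ⟨k₀, hk₀⟩ := pow_unbounded_of_one_lt (2 / r) (one_lt_two (α := ℝ))
    refine ⟨k₀, ?_⟩
    rw [div_le_iff₀ (by positivity)]
    rw [div_lt_iff₀ hr0] at hk₀
    linarith
  have hball : Metric.closedBall x₀ (2 / 2 ^ k₀) ⊆ (Ω : Set (Eu n)) ∩ V :=
    (Metric.closedBall_subset_closedBall hk₀).trans hr
  by_contra hdiv
  set t : ℕ → ℝ := fun k => 2 ^ (k + k₀) with ht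
  have ht1 : ∀ k, 1 ≤ t k := fun k => one_le_two_pow_real _
  have ht0 : ∀ k, 0 < t k := fun k => by linarith [ht1 k]
  set a : ℕ → ℝ := fun k => t k ^ p * Real.sqrt (t k ^ n) / φ (t k) with ha
  have ha0 : ∀ k, 0 < a k := fun k => by
    have := hφ.pos _ (ht1 k)
    have := ht0 k
    have : 0 < Real.sqrt (t k ^ n) := Real.sqrt_pos.2 (by positivity)
    positivity
  have hans : ¬ Summable fun k => a k ^ 2 := by
    intro hsum
    refine hdiv (integrableOn_of_summable_dyadic hφ (by linarith) _ k₀ (hsum.congr fun k => ?_))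
    have hexp : 2 * p + n - 1 + 1 = p * 2 + n := by omega
    have := ht0 k
    simp only [ha]
    rw [div_pow, mul_pow, Real.sq_sqrt (by positivity), hexp, pow_add, pow_mul]
  obtain ⟨b, hb, hbdiv⟩ := exists_summable_sq_tendsto_sum_mul_atTop ha0 hans
  let i : Fin n := ⟨0, by omega⟩
  have hθ := contDiff_monomialBump i p
  have hθ' := tsupport_monomialBump_subset i p
  obtain ⟨w, hw, hloc, hmem, ε, hε, hrem⟩ :=
    exists_lump_series_tendsto hφ hσ' (by omega : 1 ≤ n) hθ hθ' x₀ k₀ hb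
  set v : ℕ → 𝓢(Eu n, ℂ) := fun N =>
    ∑ k ∈ Finset.range N, (lumpCoeff φ n k₀ b k : ℂ) • lump hθ hθ' x₀ k₀ k with hv
  have hvw : Tendsto (fun N => SchwartzMap.toTemperedDistributionCLM (Eu n) ℂ volume (v N))
      atTop (𝓝 w) := by
    refine hw.tendsto_sum_nat.congr fun N => ?_
    simp only [hv, map_sum, map_smul]
  have hofFun : ∀ N (ψ : 𝓓(Ω, ℂ)), ofFun Ω (v N) ψ =
      SchwartzMap.toTemperedDistributionCLM (Eu n) ℂ volume (v N) (toSchwartz ψ) := by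
    intro N ψ
    rw [SchwartzMap.toTemperedDistributionCLM_apply_apply volume]
    refine integral_congr_ae (ae_of_all _ fun x => ?_)
    exact mul_comm _ _
  have hvsupp : ∀ N x, x ∉ (Ω : Set (Eu n)) → v N =ᶠ[𝓝 x] (0 : Eu n → ℂ) := by
    intro N x hx
    have hx' : x ∈ (Metric.closedBall x₀ (2 / 2 ^ k₀))ᶜ := fun h => hx (hball h).1
    filter_upwards [Metric.isClosed_closedBall.isOpen_compl.mem_nhds hx'] with y hy
    have hzero : ∀ k, lump hθ hθ' x₀ k₀ k y = 0 := by
      intro k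
      by_contra h
      refine hy (Metric.closedBall_subset_closedBall ?_
        (tsupport_lump_subset hθ' x₀ (ht1 k) (subset_tsupport _ h)))
      exact div_le_div_of_nonneg_left (by norm_num) (by positivity)
        (pow_le_pow_right₀ (by norm_num) (by omega))
    simp [hv, hzero]
  -- replace the coefficients of `A` by functions from `C₀^∞`, without a change in `Ω`
  have hcoef : ∀ μ, ∃ c : Eu n → ℂ, ContDiff ℝ ∞ c ∧ HasCompactSupport c ∧
      EqOn c (P.a μ) (Ω : Set (Eu n)) := by
    intro μ
    obtain ⟨F, hF, hFeq⟩ := hP.smooth_a μ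
    obtain ⟨c, hc, hc', hceq⟩ := exists_contDiff_hasCompactSupport_eqOn hΩ.bounded hF
    exact ⟨c, hc, hc', fun x hx => (hceq hx).trans (hFeq (subset_closure hx)).symm⟩
  choose c hc hc' hceq using hcoef
  have hA : ∀ N (ψ : 𝓓(Ω, ℂ)), ofFun Ω (P.A (v N)) ψ =
      tdDiffOp (2 * q) c (SchwartzMap.toTemperedDistributionCLM (Eu n) ℂ volume (v N))
        (toSchwartz ψ) := by
    intro N ψ
    rw [tdDiffOp_apply_schwartz _ fun μ => (hc' μ).hasTemperateGrowth (hc μ)]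
    refine integral_congr_ae (ae_of_all _ fun x => ?_)
    change diffOp (2 * q) P.a (v N) x * toSchwartz ψ x = _
    by_cases hx : x ∈ (Ω : Set (Eu n))
    · simp only [diffOp_congr (2 * q) (v N) fun μ => (hceq μ hx).symm]
    · simp only [toSchwartz_apply_eq_zero ψ hx, mul_zero]
  -- the smooth partial sums `v N` show that `(Au, 0)` is the image of `u`
  have hC := himp (restrictDistr Ω w) (restrictDistr Ω (tdDiffOp (2 * q) c w)) (fun _ => 0)
    ⟨φ, hφ, hσ, w, hmem, fun ψ => rfl⟩
    ⟨fun _ => isBdDistr_zero, φ, hφ, hσ, ⟨w, hmem, fun ψ => rfl⟩, fun N => v N,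
      fun N => (v N).smooth ⊤, ?_, fun ψ => ?_, fun j F => ?_⟩ ?_ fun j => memHBdLoc_zero V _
  rotate_left
  · have hε' : Tendsto (fun N => ε N ^ (1 / 2 : ℝ)) atTop (𝓝 0) := by
      have := (ENNReal.continuous_rpow_const (y := 1 / 2)).tendsto (0 : ℝ≥0∞) |>.comp hε
      simpa [Function.comp_def] using this
    refine tendsto_of_tendsto_of_tendsto_of_le_of_le tendsto_const_nhds hε'
      (fun _ => zero_le) fun N => ?_
    obtain ⟨g, hg, hgε, hεtop⟩ := hrem N
    refine (hNormDomain_le hg (hgε.trans_lt hεtop) fun ψ => ?_).trans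
      (ENNReal.rpow_le_rpow hgε (by norm_num))
    rw [hofFun]
    rfl
  · simp_rw [hA]
    exact PointwiseConvergenceCLM.tendsto_iff_forall_tendsto.1
      (((continuous_tdDiffOp (2 * q) c).tendsto w).comp hvw) (toSchwartz ψ)
  · refine tendsto_const_nhds.congr fun N => ?_
    symm
    rw [LinearMap.zero_apply]
    refine integral_eq_zero_of_ae (ae_of_all _ fun x => ?_)
    have hx : (x : Eu n) ∉ (Ω : Set (Eu n)) := fun h =>
      (Ω.isOpen.frontier_eq.subset x.2).2 h
    change P.B j (v N) x * F.1 x = 0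
    rw [BVP.B, diffOp_eq_zero _ _ (hvsupp N x hx), zero_mul]
  · have := (hloc.tdDiffOp hφ hc hc' : MemHContLoc φ (2 * q) _).memHLoc hΩ.bounded V
    push_cast at this
    exact this
  obtain ⟨f, hf, hfu⟩ := hC
  have hsub : (Ω : Set (Eu n)) ∩ V ⊆ localClosure Ω V := subset_union_left
  refine not_contDiffAt_of_eqOn_annuli i p k₀ (x₀ := x₀) (f := f)
    (C := fun N => ∑ k ∈ Finset.range (N + 1), a k * b k)
    (hbdiv.comp (tendsto_add_atTop_nat 1)) (fun N x hx1 hx2 => ?_)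
    ((hf.mono hsub).contDiffAt (hopen.mem_nhds hx₀))
  have hwf : ∀ ψ : 𝓢(Eu n, ℂ), HasCompactSupport ψ → tsupport ψ ⊆ (Ω : Set (Eu n)) ∩ V →
      w ψ = ∫ x, f x * ψ x := fun ψ hψ hψV =>
    hfu ⟨ψ, ψ.smooth ⊤, hψ, fun x hx => (hψV hx).1⟩ fun x hx => (hψV hx).2
  rw [eq_monomial_on_annulus i p k₀ hw hball (hf.mono hsub).continuousOn hwf N hx1 hx2]
  congr 2
  refine Finset.sum_congr rfl fun k _ => ?_
  simp only [ha, lumpCoeff, ht]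
  ring
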